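/- For a real number $c>0$ and a positive integer $N$, let $\Upsilon_c(N)$ denote the number of representations $$N=m+q,\qquad m=\lfloor p^c\rfloor,\qquad p,q \text{ prime},$$ counted as pairs $(p,q)$, so that different primes $p$ giving the same $m$ are counted separately. Let $\|c\|=\min_{n\in\mathbb Z}|c-n|$ denote the distance from $c$ to the nearest integer. Proposition. For any $C>0$ and $\delta>0$ there is a constant $K=K(C,\delta)>0$ such that $$\Upsilon_c(N)\le K\,\frac{N^{1/c}}{\log^2 N}$$ for all integers $N\ge 3$ and all real $c$ with $0<c\le C$ and $\|c\|\ge\delta$. -/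

import Mathlib

/-- The representations `N = ⌊p ^ c⌋ + q` with `p` and `q` prime, as pairs `(p, q)`.
The part `m = ⌊p ^ c⌋` satisfies `m ≤ N` automatically. -/
def primeFloorReps (c : ℝ) (N : ℕ) : Set (ℕ × ℕ) :=
  {x | x.1.Prime ∧ x.2.Prime ∧ N = ⌊(x.1 : ℝ) ^ c⌋₊ + x.2}

/-- `Υ_c(N)`: the number of representations `N = m + q` with `m = ⌊p ^ c⌋` and `p`, `q` prime.
Each prime `p` is counted (this matters for `c < 1`, where several primes `p` can give the same
`m`). For `c > 0` the set is finite, see `primeFloorReps_finite`. -/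
noncomputable def Upsilon (c : ℝ) (N : ℕ) : ℕ := (primeFloorReps c N).ncard

/-- For `c > 0` the cardinality in `Upsilon` is that of a finite set. -/
theorem primeFloorReps_finite {c : ℝ} (hc : 0 < c) (N : ℕ) : (primeFloorReps c N).Finite := by
  refine ((Set.finite_Iic ⌊((N : ℝ) + 1) ^ c⁻¹⌋₊).prod (Set.finite_Iic N)).subset ?_
  rintro ⟨p, q⟩ ⟨_, _, h⟩
  dsimp only at h
  refine ⟨?_, by simp only [Set.mem_Iic]; omega⟩
  simp only [Set.mem_Iic]
  apply Nat.le_floor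
  have h0 : (0 : ℝ) ≤ (p : ℝ) ^ c := by positivity
  have h1 : (p : ℝ) ^ c ≤ (N : ℝ) + 1 := by
    have h2 := Nat.lt_floor_add_one ((p : ℝ) ^ c)
    have h3 : ((⌊(p : ℝ) ^ c⌋₊ : ℕ) : ℝ) ≤ N := by exact_mod_cast (by omega)
    linarith
  calc (p : ℝ) = ((p : ℝ) ^ c) ^ c⁻¹ := (Real.rpow_rpow_inv (by positivity) hc.ne').symm
    _ ≤ ((N : ℝ) + 1) ^ c⁻¹ := Real.rpow_le_rpow h0 h1 (by positivity)

/-- The number of distinct values `m` is at most `Upsilon c N`, so that an upper bound for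
`Upsilon c N` also bounds the count without multiplicity. -/
theorem ncard_values_le_Upsilon {c : ℝ} (hc : 0 < c) (N : ℕ) :
    {m : ℕ | m ≤ N ∧ ∃ p q : ℕ, p.Prime ∧ q.Prime ∧ m = ⌊(p : ℝ) ^ c⌋₊ ∧ N = m + q}.ncard
      ≤ Upsilon c N := by
  refine le_trans (Set.ncard_le_ncard ?_ ((primeFloorReps_finite hc N).image
    (fun x => ⌊(x.1 : ℝ) ^ c⌋₊))) (Set.ncard_image_le (primeFloorReps_finite hc N))
  rintro m ⟨_, p, q, hp, hq, hm, hN⟩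
  exact ⟨(p, q), ⟨hp, hq, by simp only; omega⟩, hm.symm⟩

/-! This is an upper-bound sieve. With `X = (N + 1) ^ (1 / c)`, every counted prime `p` is at most
`X`, and `p` determines `q`. Apart from `p ≤ X / Q` and those `p` with `q ≤ R`, both negligible,
neither `p` nor `N - ⌊p ^ c⌋` has a divisor in `[2, R]`. Taking `R` to be a small fixed power of
`N`, each of the two conditions should save a factor `log N`.

The sieve (`card_sifted_le`) majorises each condition by a square `(∑ λ_d)²` with the same Selberg
weights. No coprimality between the moduli `D ∣ n` and `e ∣ N - ⌊n ^ c⌋` is needed: the second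
condition is equidistributed within each class of the first, so the main term is the product of two
one-dimensional Selberg forms, each equal to `1 / selbergG R ≤ 1 / log (R + 1)`.

Equidistribution of `⌊n ^ c⌋` modulo `e` is needed only as an upper bound, so the indicator of `⌊y⌋
≡ m` modulo a common multiple `E` of all sieve moduli is replaced by twice a Fejér kernel at `y -
m`. This costs a constant factor, and in `abs_sum_fejer_sub_le` only the frequencies `h / e` with `0
< |h| < e` survive, whatever the size of `E`.

The remaining input is a power saving for `∑ e(γ n ^ c)` over multiples of `D`
(`norm_sum_unitExp_rpow_le`). If `s = ⌊c⌋`, then `s` van der Corput differencings leave a phase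
whose increments are governed by the derivative of order `s + 1`, of size about `X ^ (c - s - 1)`.
Since `‖c‖ ≥ δ`, this lies between `X ^ (δ - 1)` and `X ^ (-δ)`, up to powers of `Q`, so the
Kusmin–Landau inequality applies. All parameters depend only on `C` and `δ`, which gives uniformity
in `c`. -/

/-! ### Selberg weights and their quadratic form. -/

/-- For squarefree `m`, the reciprocals of the integers with radical `m` sum to at most `1 / φ m`. -/
lemma sum_inv_radical_eq_le {m : ℕ} (hm : Squarefree m) (t : Finset ℕ)
    (ht : ∀ n ∈ t, n ≠ 0 ∧ ∏ p ∈ n.primeFactors, p = m) :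
    ∑ n ∈ t, (1 / n : ℝ) ≤ 1 / (m.totient : ℝ) := by
  have hm0 : m ≠ 0 := hm.ne_zero
  let f : ℕ →* ℝ :=
    { toFun := fun n => (n : ℝ)⁻¹, map_one' := by simp, map_mul' := by intro a b; simp [mul_comm] }
  have hf : ∀ {p : ℕ}, p.Prime → ‖f p‖ < 1 := by
    intro p hp
    have : (1 : ℝ) < p := by exact_mod_cast hp.one_lt
    simp only [f, MonoidHom.coe_mk, OneHom.coe_mk, norm_inv, Real.norm_natCast]
    exact inv_lt_one_of_one_lt₀ this
  have hs := (EulerProduct.summable_and_hasSum_factoredNumbers_prod_filter_prime_geometric hf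
    m.primeFactors).2
  have hfilter : m.primeFactors.filter Nat.Prime = m.primeFactors :=
    Finset.filter_true_of_mem fun p hp => Nat.prime_of_mem_primeFactors hp
  rw [hfilter] at hs
  have hs' := (hasSum_subtype_iff_indicator (f := fun n => f n)).1 hs
  have hdvd : ∀ n ∈ t, m ∣ n := fun n hn => by
    rw [← (ht n hn).2]; exact Nat.prod_primeFactors_dvd n
  have hinj : Set.InjOn (fun n => n / m) (t : Set ℕ) := by
    intro a ha b hb hab
    exact (Nat.div_left_inj (hdvd a ha) (hdvd b hb)).1 hab
  have hle := sum_le_hasSum (t.image fun n => n / m)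
    (fun i _ => Set.indicator_nonneg (fun n _ => by simp [f]) i) hs'
  rw [Finset.sum_image hinj] at hle
  -- An integer with radical `m` is `m * k` with `k` composed of primes dividing `m`; the sum over
  -- all such `k` is an Euler product, and `m * ∏ (1 - 1 / p) = φ m`.
  have hterm : ∀ n ∈ t, (1 / n : ℝ) = (1 / m : ℝ) *
      (Nat.factoredNumbers m.primeFactors).indicator (fun n => f n) (n / m) := by
    intro n hn
    obtain ⟨k, rfl⟩ := hdvd n hn
    have hk : k ≠ 0 := fun h => (ht _ hn).1 (by simp [h])
    have hpf : (m * k).primeFactors = m.primeFactors := by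
      conv_rhs => rw [← (ht _ hn).2]
      rw [Nat.primeFactors_prod fun p hp => Nat.prime_of_mem_primeFactors hp]
    rw [Nat.mul_div_cancel_left k (Nat.pos_of_ne_zero hm0), Set.indicator_of_mem]
    · simp [f, mul_comm]
    · apply Nat.mem_factoredNumbers_of_primeFactors_subset hk
      rw [← hpf]
      exact Nat.primeFactors_mono (dvd_mul_left k m) (mul_ne_zero hm0 hk)
  rw [Finset.sum_congr rfl hterm, ← Finset.mul_sum]
  have hphi : (m.totient : ℝ) = m * ∏ p ∈ m.primeFactors, (1 - (p : ℝ)⁻¹) := by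
    have := congrArg (fun x : ℚ => (x : ℝ)) (Nat.totient_eq_mul_prod_factors m)
    push_cast at this
    exact this
  calc _ ≤ (1 / m : ℝ) * ∏ p ∈ m.primeFactors, (1 - f p)⁻¹ := by gcongr
    _ = 1 / (m.totient : ℝ) := by
      rw [hphi, Finset.prod_inv_distrib]
      simp [f, mul_comm]

/-- The normalising sum of the Selberg sieve for the density `1 / p`. -/
noncomputable def selbergG (R : ℕ) : ℝ :=
  ∑ m ∈ Finset.Icc 1 R, (ArithmeticFunction.moebius m : ℝ) ^ 2 / (m.totient : ℝ)

/-- Grouping the harmonic sum up to `R` by the radical `m` of `n`, the fibre over a squarefree `m`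
contributes at most `1 / φ m`, and the other fibres are empty. -/
lemma log_le_selbergG (R : ℕ) : Real.log (R + 1) ≤ selbergG R := by
  have h1 : Real.log (R + 1) ≤ ∑ n ∈ Finset.Icc 1 R, (1 / n : ℝ) := by
    have := log_add_one_le_harmonic R
    rw [harmonic_eq_sum_Icc] at this
    push_cast at this
    simpa using this
  refine h1.trans ?_
  have hrad : ∀ n ∈ Finset.Icc 1 R, ∏ p ∈ n.primeFactors, p ∈ Finset.Icc 1 R := by
    intro n hn
    rw [Finset.mem_Icc] at hn ⊢
    exact ⟨Finset.prod_pos fun p hp => (Nat.prime_of_mem_primeFactors hp).pos,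
      (Nat.le_of_dvd hn.1 (Nat.prod_primeFactors_dvd n)).trans hn.2⟩
  rw [← Finset.sum_fiberwise_of_maps_to hrad, selbergG]
  refine Finset.sum_le_sum fun m _ => ?_
  by_cases hsq : Squarefree m
  · have : (ArithmeticFunction.moebius m : ℝ) ^ 2 = 1 := by
      exact_mod_cast ArithmeticFunction.moebius_sq_eq_one_of_squarefree hsq
    rw [this]
    refine sum_inv_radical_eq_le hsq _ fun n hn => ?_
    simp only [Finset.mem_filter, Finset.mem_Icc] at hn
    exact ⟨by omega, hn.2⟩
  · rw [Finset.sum_eq_zero]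
    · positivity
    · intro n hn
      rw [Finset.mem_filter] at hn
      exfalso
      apply hsq
      rw [← hn.2]
      refine Finset.squarefree_prod_of_pairwise_isCoprime (fun p hp q hq hpq => ?_)
        fun p hp => (Nat.prime_of_mem_primeFactors hp).prime.squarefree
      simp only [Function.onFun]
      rw [← Nat.coprime_iff_isRelPrime]
      exact (Nat.coprime_primes (Nat.prime_of_mem_primeFactors hp)
        (Nat.prime_of_mem_primeFactors hq)).2 hpq

/-- Möbius cancellation over the interval `m ∣ d ∣ k` of the divisibility order. -/
lemma sum_moebius_between {R m k : ℕ} (hm : m ≠ 0) (hk : k ∈ Finset.Icc 1 R) :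
    ∑ d ∈ Finset.Icc 1 R, (if m ∣ d ∧ d ∣ k then (ArithmeticFunction.moebius (k / d) : ℝ) else 0)
      = if m = k then 1 else 0 := by
  rw [Finset.mem_Icc] at hk
  by_cases hmk : m ∣ k
  · obtain ⟨l, rfl⟩ := hmk
    have hl : l ≠ 0 := by rintro rfl; simp at hk
    rw [← Finset.sum_filter]
    have key : ∑ d ∈ Finset.Icc 1 R with m ∣ d ∧ d ∣ m * l,
        (ArithmeticFunction.moebius (m * l / d) : ℝ) =
        ∑ i ∈ l.divisors, (ArithmeticFunction.moebius (l / i) : ℝ) := by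
      symm
      refine Finset.sum_nbij' (fun i => m * i) (fun d => d / m) ?_ ?_ ?_ ?_ ?_
      · intro i hi
        have hi' := (Nat.mem_divisors.1 hi).1
        have : m * i ∣ m * l := mul_dvd_mul_left m hi'
        simp only [Finset.mem_filter, Finset.mem_Icc]
        refine ⟨⟨Nat.pos_of_ne_zero (mul_ne_zero hm ?_), (Nat.le_of_dvd hk.1 this).trans hk.2⟩,
          dvd_mul_right _ _, this⟩
        rintro rfl; simp at hi' ; exact hl hi'
      · intro d hd
        simp only [Finset.mem_filter] at hd
        obtain ⟨_, ⟨i, rfl⟩, h2⟩ := hd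
        rw [Nat.mul_div_cancel_left i (Nat.pos_of_ne_zero hm), Nat.mem_divisors]
        exact ⟨Nat.dvd_of_mul_dvd_mul_left (Nat.pos_of_ne_zero hm) h2, hl⟩
      · intro i _
        exact Nat.mul_div_cancel_left i (Nat.pos_of_ne_zero hm)
      · intro d hd
        simp only [Finset.mem_filter] at hd
        exact Nat.mul_div_cancel' hd.2.1
      · intro i _
        rw [Nat.mul_div_mul_left _ _ (Nat.pos_of_ne_zero hm)]
    rw [key, Nat.sum_div_divisors l (fun i => (ArithmeticFunction.moebius i : ℝ))]
    have h := ArithmeticFunction.coe_mul_zeta_apply (f := (ArithmeticFunction.moebius)) (x := l)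
    rw [ArithmeticFunction.moebius_mul_coe_zeta, ArithmeticFunction.one_apply] at h
    have h' : ∑ i ∈ l.divisors, (ArithmeticFunction.moebius i : ℝ) = if l = 1 then 1 else 0 := by
      exact_mod_cast h.symm
    rw [h']
    congr 1
    rw [eq_iff_iff]
    constructor
    · rintro rfl; simp
    · intro h
      have : m * 1 = m * l := by simpa using h
      exact (Nat.eq_of_mul_eq_mul_left (Nat.pos_of_ne_zero hm) this).symm
  · rw [Finset.sum_eq_zero, if_neg]
    · rintro rfl; exact hmk dvd_rfl
    · intro d _
      rw [if_neg]
      rintro ⟨h1, h2⟩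
      exact hmk (h1.trans h2)

/-- The diagonalised Selberg weights. -/
noncomputable def selbergY (R m : ℕ) : ℝ :=
  (ArithmeticFunction.moebius m : ℝ) / ((m.totient : ℝ) * selbergG R)

/-- The Selberg weights for the density `1 / p`. -/
noncomputable def selbergWeight (R d : ℕ) : ℝ :=
  d * ∑ k ∈ Finset.Icc 1 R, if d ∣ k then (ArithmeticFunction.moebius (k / d) : ℝ) * selbergY R k
    else 0

lemma selbergG_pos {R : ℕ} (hR : 1 ≤ R) : 0 < selbergG R := by
  refine lt_of_lt_of_le (Real.log_pos ?_) (log_le_selbergG R)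
  have : (1 : ℝ) ≤ R := by exact_mod_cast hR
  linarith

lemma selbergWeight_one {R : ℕ} (hR : 1 ≤ R) : selbergWeight R 1 = 1 := by
  have hG := selbergG_pos hR
  simp only [selbergWeight, selbergY, Nat.cast_one, one_mul, one_dvd, if_true, Nat.div_one]
  have : ∀ k ∈ Finset.Icc 1 R, (ArithmeticFunction.moebius k : ℝ) *
      ((ArithmeticFunction.moebius k : ℝ) / ((k.totient : ℝ) * selbergG R)) =
      (ArithmeticFunction.moebius k : ℝ) ^ 2 / (k.totient : ℝ) / selbergG R := by
    intro k _
    rw [div_div, ← mul_div_assoc, sq]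
  rw [Finset.sum_congr rfl this, ← Finset.sum_div, ← selbergG, div_self hG.ne']

/-- This crude bound is enough because the exponential sums save a large power of `R`. -/
lemma abs_selbergWeight_le {R : ℕ} (hR : 1 ≤ R) (d : ℕ) : |selbergWeight R d| ≤ d := by
  have hG := selbergG_pos hR
  rw [selbergWeight, abs_mul, Nat.abs_cast]
  refine mul_le_of_le_one_right (Nat.cast_nonneg d) ?_
  refine (Finset.abs_sum_le_sum_abs _ _).trans ?_
  calc _ ≤ ∑ k ∈ Finset.Icc 1 R,
        (ArithmeticFunction.moebius k : ℝ) ^ 2 / (k.totient : ℝ) / selbergG R := by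
        refine Finset.sum_le_sum fun k _ => ?_
        have hmu : |(ArithmeticFunction.moebius k : ℝ)| = (ArithmeticFunction.moebius k : ℝ) ^ 2 := by
          rcases ArithmeticFunction.moebius_eq_or k with h | h | h <;> simp [h]
        split_ifs
        · have h1 : |(ArithmeticFunction.moebius (k / d) : ℝ)| ≤ 1 := by
            exact_mod_cast ArithmeticFunction.abs_moebius_le_one
          rw [abs_mul, selbergY, abs_div, hmu, abs_of_nonneg (a := (k.totient : ℝ) * selbergG R) (by positivity),
            ← div_div]
          exact mul_le_of_le_one_left (by positivity) h1
        · rw [abs_zero]; positivity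
    _ = 1 := by rw [← Finset.sum_div, ← selbergG, div_self hG.ne']

/-- Möbius inversion over multiples: these are the coordinates in which the quadratic form of the
sieve is diagonal. -/
lemma sum_selbergWeight_div {R m : ℕ} (hm : m ∈ Finset.Icc 1 R) :
    ∑ d ∈ Finset.Icc 1 R, (if m ∣ d then selbergWeight R d / d else 0) = selbergY R m := by
  have hm0 : m ≠ 0 := by rw [Finset.mem_Icc] at hm; omega
  calc _ = ∑ d ∈ Finset.Icc 1 R, ∑ k ∈ Finset.Icc 1 R,
        (if m ∣ d ∧ d ∣ k then (ArithmeticFunction.moebius (k / d) : ℝ) else 0) * selbergY R k := by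
        refine Finset.sum_congr rfl fun d hd => ?_
        have hd0 : (d : ℝ) ≠ 0 := by
          rw [Finset.mem_Icc] at hd
          exact_mod_cast (by omega : d ≠ 0)
        by_cases h : m ∣ d
        · simp only [h, if_true, true_and, selbergWeight]
          rw [mul_div_cancel_left₀ _ hd0]
          refine Finset.sum_congr rfl fun k _ => ?_
          split_ifs <;> simp
        · simp [h]
    _ = ∑ k ∈ Finset.Icc 1 R, (if m = k then 1 else 0) * selbergY R k := by
        rw [Finset.sum_comm]
        refine Finset.sum_congr rfl fun k hk => ?_
        rw [← Finset.sum_mul, sum_moebius_between hm0 hk]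
    _ = selbergY R m := by
        simp [Finset.sum_ite_eq, hm]

/-- The quadratic form of the Selberg sieve at its minimum. -/
lemma sum_selbergWeight_lcm {R : ℕ} (hR : 1 ≤ R) :
    ∑ d ∈ Finset.Icc 1 R, ∑ e ∈ Finset.Icc 1 R,
      selbergWeight R d * selbergWeight R e / (Nat.lcm d e : ℝ) = 1 / selbergG R := by
  have hG := selbergG_pos hR
  have h1 : ∀ d ∈ Finset.Icc 1 R, ∀ e ∈ Finset.Icc 1 R,
      selbergWeight R d * selbergWeight R e / (Nat.lcm d e : ℝ) = ∑ m ∈ Finset.Icc 1 R,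
        (m.totient : ℝ) * ((if m ∣ d then selbergWeight R d / d else 0) *
          (if m ∣ e then selbergWeight R e / e else 0)) := by
    intro d hd e he
    rw [Finset.mem_Icc] at hd he
    have hd0 : (d : ℝ) ≠ 0 := by exact_mod_cast (by omega : d ≠ 0)
    have he0 : (e : ℝ) ≠ 0 := by exact_mod_cast (by omega : e ≠ 0)
    -- Writing `1 / lcm` as `gcd / (d * e)` and the gcd as a sum of totients over common divisors
    -- turns the form into `∑ φ(m) y_m ^ 2`.
    have hg : (Nat.gcd d e : ℝ) = ∑ m ∈ Finset.Icc 1 R, if m ∣ d ∧ m ∣ e then (m.totient : ℝ) else 0 := by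
      have hgp : 0 < Nat.gcd d e := Nat.gcd_pos_of_pos_left _ hd.1
      have := Nat.sum_totient (Nat.gcd d e)
      rw [← Finset.sum_filter]
      have hset : (Finset.Icc 1 R).filter (fun m => m ∣ d ∧ m ∣ e) = (Nat.gcd d e).divisors := by
        ext m
        simp only [Finset.mem_filter, Finset.mem_Icc, Nat.mem_divisors, Nat.dvd_gcd_iff]
        constructor
        · rintro ⟨_, h⟩; exact ⟨h, hgp.ne'⟩
        · rintro ⟨h, _⟩
          exact ⟨⟨Nat.pos_of_dvd_of_pos h.1 hd.1, (Nat.le_of_dvd hd.1 h.1).trans hd.2⟩, h⟩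
      rw [hset]
      exact_mod_cast this.symm
    have hgl : (Nat.gcd d e : ℝ) * Nat.lcm d e = d * e := by exact_mod_cast Nat.gcd_mul_lcm d e
    have hl0 : (Nat.lcm d e : ℝ) ≠ 0 := by
      intro h; rw [h, mul_zero] at hgl; exact mul_ne_zero hd0 he0 hgl.symm
    have : selbergWeight R d * selbergWeight R e / (Nat.lcm d e : ℝ) =
        (Nat.gcd d e : ℝ) * (selbergWeight R d / d * (selbergWeight R e / e)) := by
      field_simp
      linear_combination (-(selbergWeight R d * selbergWeight R e)) * hgl
    rw [this, hg, Finset.sum_mul]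
    refine Finset.sum_congr rfl fun m _ => ?_
    by_cases h1 : m ∣ d <;> by_cases h2 : m ∣ e <;> simp [h1, h2]
  rw [Finset.sum_congr rfl fun d hd => Finset.sum_congr rfl (h1 d hd)]
  calc _ = ∑ m ∈ Finset.Icc 1 R, (m.totient : ℝ) *
        ((∑ d ∈ Finset.Icc 1 R, if m ∣ d then selbergWeight R d / d else 0) *
          ∑ e ∈ Finset.Icc 1 R, if m ∣ e then selbergWeight R e / e else 0) := by
        rw [Finset.sum_congr rfl fun d _ => Finset.sum_comm, Finset.sum_comm]
        refine Finset.sum_congr rfl fun m _ => ?_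
        rw [Finset.sum_mul_sum, Finset.mul_sum]
        refine Finset.sum_congr rfl fun d _ => ?_
        rw [Finset.mul_sum]
    _ = ∑ m ∈ Finset.Icc 1 R,
        (ArithmeticFunction.moebius m : ℝ) ^ 2 / (m.totient : ℝ) / selbergG R ^ 2 := by
        refine Finset.sum_congr rfl fun m hm => ?_
        rw [sum_selbergWeight_div hm, selbergY]
        have : (m.totient : ℝ) ≠ 0 := by
          rw [Finset.mem_Icc] at hm
          exact_mod_cast (Nat.totient_pos.2 hm.1).ne'
        field_simp
    _ = 1 / selbergG R := by
        rw [← Finset.sum_div, ← selbergG]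
        field_simp

/-! ### Additive characters and the Kusmin–Landau inequality. -/

/-- `unitExp x = exp (2 π i x)`. -/
noncomputable def unitExp (x : ℝ) : ℂ := Complex.exp ((2 * Real.pi * x : ℝ) * Complex.I)

lemma unitExp_zero : unitExp 0 = 1 := by simp [unitExp]

lemma unitExp_add (x y : ℝ) : unitExp (x + y) = unitExp x * unitExp y := by
  rw [unitExp, unitExp, unitExp, ← Complex.exp_add]
  congr 1
  push_cast
  ring

lemma norm_unitExp (x : ℝ) : ‖unitExp x‖ = 1 := Complex.norm_exp_ofReal_mul_I _

lemma unitExp_neg (x : ℝ) : unitExp (-x) = starRingEnd ℂ (unitExp x) := by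
  rw [unitExp, unitExp, ← Complex.exp_conj, map_mul, Complex.conj_ofReal, Complex.conj_I]
  congr 1
  push_cast
  ring

lemma unitExp_sub (x y : ℝ) : unitExp (x - y) = unitExp x * starRingEnd ℂ (unitExp y) := by
  rw [sub_eq_add_neg, unitExp_add, unitExp_neg]

lemma unitExp_intCast (n : ℤ) : unitExp n = 1 := by
  rw [unitExp, ← Complex.exp_int_mul_two_pi_mul_I n]
  congr 1
  push_cast
  ring

lemma norm_one_sub_unitExp (x : ℝ) : ‖1 - unitExp x‖ = 2 * |Real.sin (Real.pi * x)| := by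
  rw [norm_sub_rev, unitExp, mul_comm, Complex.norm_exp_I_mul_ofReal_sub_one, norm_mul,
    Real.norm_eq_abs, Real.norm_eq_abs, abs_of_pos (by norm_num : (0 : ℝ) < 2)]
  congr 3
  ring

lemma norm_unitExp_sub_le (x y : ℝ) : ‖unitExp x - unitExp y‖ ≤ 2 * Real.pi * |x - y| := by
  have h : unitExp x - unitExp y = unitExp y * (unitExp (x - y) - 1) := by
    rw [mul_sub, ← unitExp_add]; simp
  rw [h, norm_mul, norm_unitExp, one_mul, unitExp, mul_comm]
  refine Real.norm_exp_I_mul_ofReal_sub_one_le.trans ?_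
  rw [Real.norm_eq_abs, abs_mul, abs_of_pos (by positivity : 0 < 2 * Real.pi)]

/-- Jordan's inequality `sin t ≥ 2 t / π` on `[0, π / 2]`. -/
lemma four_mul_le_norm_one_sub_unitExp {x : ℝ} (h0 : 0 ≤ x) (h1 : x ≤ 1 / 2) :
    4 * x ≤ ‖1 - unitExp x‖ := by
  have hpi := Real.pi_pos
  have h := Real.mul_le_sin (x := Real.pi * x) (by positivity) (by nlinarith)
  rw [norm_one_sub_unitExp]
  have h2 : 2 / Real.pi * (Real.pi * x) = 2 * x := by field_simp
  rw [h2] at h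
  have := le_abs_self (Real.sin (Real.pi * x))
  linarith

/-- A weak Kusmin–Landau inequality: the increments lie in `[l, 1/2]` and vary slowly. -/
lemma norm_sum_unitExp_le_of_increments (g : ℕ → ℝ) (n : ℕ) {l μ : ℝ} (hl : 0 < l)
    (h1 : ∀ k ≤ n, l ≤ g (k + 1) - g k) (h2 : ∀ k ≤ n, g (k + 1) - g k ≤ 1 / 2)
    (h3 : ∀ k < n, |(g (k + 2) - g (k + 1)) - (g (k + 1) - g k)| ≤ μ) :
    ‖∑ k ∈ Finset.range n, unitExp (g k)‖ ≤ 1 / l + n * μ / l ^ 2 := by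
  set a : ℕ → ℂ := fun k => unitExp (g k) with ha
  set v : ℕ → ℂ := fun k => 1 - unitExp (g (k + 1) - g k) with hv
  have hvl : ∀ k ≤ n, 4 * l ≤ ‖v k‖ := fun k hk =>
    (by linarith [h1 k hk] : 4 * l ≤ 4 * (g (k + 1) - g k)).trans
      (four_mul_le_norm_one_sub_unitExp (by linarith [h1 k hk]) (h2 k hk))
  have hv0 : ∀ k ≤ n, v k ≠ 0 := fun k hk => by
    rw [← norm_pos_iff]; linarith [hvl k hk]
  have hinv : ∀ k ≤ n, ‖(v k)⁻¹‖ ≤ 1 / (4 * l) := fun k hk => by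
    rw [norm_inv, ← one_div]
    exact one_div_le_one_div_of_le (by positivity) (hvl k hk)
  have hμ : 0 < n → 0 ≤ μ := fun hn => (abs_nonneg _).trans (h3 0 hn)
  have hdiff : ∀ k < n, ‖(v (k + 1))⁻¹ - (v k)⁻¹‖ ≤ μ / (2 * l ^ 2) := fun k hk => by
    rw [inv_sub_inv (hv0 _ (by omega)) (hv0 k hk.le), norm_div, norm_mul]
    have hnum : ‖v k - v (k + 1)‖ ≤ 8 * μ := by
      have : v k - v (k + 1) =
          unitExp (g (k + 2) - g (k + 1)) - unitExp (g (k + 1) - g k) := by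
        simp only [hv]; ring
      rw [this]
      refine (norm_unitExp_sub_le _ _).trans ?_
      have hp := Real.pi_lt_four
      have h0 := Real.pi_pos
      have := h3 k hk
      have hm := hμ (by omega)
      calc _ ≤ 2 * Real.pi * μ := by gcongr
        _ ≤ 8 * μ := by nlinarith
    calc _ ≤ 8 * μ / (4 * l * (4 * l)) := by
          have := hμ (by omega)
          gcongr
          · exact hvl _ (by omega)
          · exact hvl _ (by omega)
      _ = μ / (2 * l ^ 2) := by field_simp; ring
  -- Summation by parts: `a (k + 1) = a k * (1 - v k)` gives `a k = (a k - a (k + 1)) / v k`, so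
  -- once the boundary term `a m / v m` is added, each step changes the sum only by the variation of
  -- `1 / v`.
  have hT : ∀ m ≤ n, ‖(∑ k ∈ Finset.range m, a k) + a m * (v m)⁻¹‖ ≤
      1 / (4 * l) + m * (μ / (2 * l ^ 2)) := by
    intro m
    induction m with
    | zero =>
      intro _
      simpa [ha, norm_unitExp] using hinv 0 (Nat.zero_le _)
    | succ m ih =>
      intro hm
      have key : (∑ k ∈ Finset.range (m + 1), a k) + a (m + 1) * (v (m + 1))⁻¹ =
          ((∑ k ∈ Finset.range m, a k) + a m * (v m)⁻¹) +
            a (m + 1) * ((v (m + 1))⁻¹ - (v m)⁻¹) := by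
        have hs : a (m + 1) = a m * (1 - v m) := by
          simp only [ha, hv, sub_sub_cancel]
          rw [← unitExp_add]; congr 1; ring
        have hvm := hv0 m (by omega)
        rw [Finset.sum_range_succ, hs]
        field_simp
        ring
      rw [key]
      refine (norm_add_le _ _).trans ?_
      have h5 := ih (by omega)
      have h6 := hdiff m (by omega)
      rw [norm_mul, show ‖a (m + 1)‖ = 1 from norm_unitExp _, one_mul]
      push_cast
      linarith
  have hfin : ‖∑ k ∈ Finset.range n, a k‖ ≤
      ‖(∑ k ∈ Finset.range n, a k) + a n * (v n)⁻¹‖ + ‖a n * (v n)⁻¹‖ := by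
    simpa using norm_sub_le ((∑ k ∈ Finset.range n, a k) + a n * (v n)⁻¹) (a n * (v n)⁻¹)
  have h7 : ‖a n * (v n)⁻¹‖ ≤ 1 / (4 * l) := by
    rw [norm_mul, show ‖a n‖ = 1 from norm_unitExp _, one_mul]; exact hinv n le_rfl
  have h8 := hT n le_rfl
  have h9 : 0 ≤ n * μ := by
    rcases Nat.eq_zero_or_pos n with h | h
    · simp [h]
    · have := hμ h; positivity
  have h10 : 1 / (4 * l) + n * (μ / (2 * l ^ 2)) + 1 / (4 * l) =
      (1 / l) / 2 + (n * μ / l ^ 2) / 2 := by field_simp; ring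
  have h11 : 0 ≤ 1 / l := by positivity
  have h12 : 0 ≤ n * μ / l ^ 2 := by positivity
  linarith

/-! ### Van der Corput differencing. -/

/-- The van der Corput inequality. -/
lemma norm_sum_sq_le_of_correlations (z : ℕ → ℂ) (M H : ℕ) (hH : 1 ≤ H) (hz : ∀ n, ‖z n‖ ≤ 1)
    {B : ℝ} (hB0 : 0 ≤ B) (hB : ∀ h, 1 ≤ h → h < H →
      ‖∑ n ∈ Finset.range (M - h), z (n + h) * starRingEnd ℂ (z n)‖ ≤ B) :
    ‖∑ n ∈ Finset.range M, z n‖ ^ 2 ≤ (M + H) * (M / H + B) := by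
  -- `H` translates of the sequence, extended by zero, all fit in a window of length `M + H`.
  -- Summing over both `t` and `h` counts the original sum `H` times, and Cauchy–Schwarz in `t`
  -- produces the correlations.
  set w : ℕ → ℕ → ℂ := fun t h => if h ≤ t ∧ t - h < M then z (t - h) else 0 with hw
  have hsum : ∀ h ∈ Finset.range H, ∑ t ∈ Finset.range (M + H), w t h =
      ∑ n ∈ Finset.range M, z n := by
    intro h hh
    rw [Finset.mem_range] at hh
    simp only [hw]
    rw [← Finset.sum_filter]
    refine Finset.sum_nbij' (fun t => t - h) (fun n => n + h) ?_ ?_ ?_ ?_ ?_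
    · intro t ht; simp only [Finset.mem_filter, Finset.mem_range] at ht ⊢; omega
    · intro n hn; simp only [Finset.mem_filter, Finset.mem_range] at hn ⊢; omega
    · intro t ht; simp only [Finset.mem_filter, Finset.mem_range] at ht; omega
    · intro n _; omega
    · intro t _; rfl
  have hcor : ∀ h h', h < h' → h' < H →
      ‖∑ t ∈ Finset.range (M + H), w t h * starRingEnd ℂ (w t h')‖ ≤ B := by
    intro h h' hlt hlt'
    have : ∑ t ∈ Finset.range (M + H), w t h * starRingEnd ℂ (w t h') =
        ∑ n ∈ Finset.range (M - (h' - h)), z (n + (h' - h)) * starRingEnd ℂ (z n) := by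
      have h1 : ∀ t, w t h * starRingEnd ℂ (w t h') =
          if h' ≤ t ∧ t - h < M then z (t - h) * starRingEnd ℂ (z (t - h')) else 0 := by
        intro t
        simp only [hw]
        split_ifs <;> first | rfl | (exfalso; omega) | simp
      rw [Finset.sum_congr rfl fun t _ => h1 t, ← Finset.sum_filter]
      refine Finset.sum_nbij' (fun t => t - h') (fun n => n + h') ?_ ?_ ?_ ?_ ?_
      · intro t ht; simp only [Finset.mem_filter, Finset.mem_range] at ht ⊢; omega
      · intro n hn; simp only [Finset.mem_filter, Finset.mem_range] at hn ⊢; omega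
      · intro t ht; simp only [Finset.mem_filter, Finset.mem_range] at ht; omega
      · intro n _; omega
      · intro t ht
        simp only [Finset.mem_filter, Finset.mem_range] at ht
        rw [show t - h' + (h' - h) = t - h by omega]
    rw [this]
    exact hB _ (by omega) (by omega)
  have hcor' : ∀ h ∈ Finset.range H, ∀ h' ∈ Finset.range H,
      ‖∑ t ∈ Finset.range (M + H), w t h * starRingEnd ℂ (w t h')‖ ≤
        (if h = h' then (M : ℝ) else 0) + B := by
    intro h hh h' hh'
    rw [Finset.mem_range] at hh hh'
    rcases lt_trichotomy h h' with hlt | rfl | hlt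
    · rw [if_neg hlt.ne, zero_add]; exact hcor h h' hlt hh'
    · rw [if_pos rfl]
      have hle : ‖∑ t ∈ Finset.range (M + H), w t h * starRingEnd ℂ (w t h)‖ ≤ M := by
        refine (norm_sum_le _ _).trans ?_
        calc _ ≤ ∑ t ∈ Finset.range (M + H), if h ≤ t ∧ t - h < M then (1 : ℝ) else 0 := by
              refine Finset.sum_le_sum fun t _ => ?_
              simp only [hw]
              split_ifs
              · rw [norm_mul, RCLike.norm_conj]
                exact mul_le_one₀ (hz _) (norm_nonneg _) (hz _)
              · simp
          _ = ((Finset.range (M + H)).filter fun t => h ≤ t ∧ t - h < M).card := by simp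
          _ ≤ M := by
              have : (Finset.range (M + H)).filter (fun t => h ≤ t ∧ t - h < M) ⊆
                  Finset.Ico h (h + M) := by
                intro t ht
                simp only [Finset.mem_filter, Finset.mem_range, Finset.mem_Ico] at ht ⊢
                omega
              have := Finset.card_le_card this
              simp only [Nat.card_Ico, Nat.add_sub_cancel_left] at this
              exact_mod_cast this
      linarith
    · rw [if_neg hlt.ne', zero_add]
      have : ∑ t ∈ Finset.range (M + H), w t h * starRingEnd ℂ (w t h') =
          starRingEnd ℂ (∑ t ∈ Finset.range (M + H), w t h' * starRingEnd ℂ (w t h)) := by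
        rw [map_sum]
        refine Finset.sum_congr rfl fun t _ => ?_
        rw [map_mul, Complex.conj_conj, mul_comm]
      rw [this, RCLike.norm_conj]
      exact hcor h' h hlt hh
  set v : ℕ → ℂ := fun t => ∑ h ∈ Finset.range H, w t h with hv
  have hHS : (H : ℂ) * ∑ n ∈ Finset.range M, z n = ∑ t ∈ Finset.range (M + H), v t := by
    simp only [hv]
    rw [Finset.sum_comm, Finset.sum_congr rfl hsum]
    simp
  have hCS : ‖∑ t ∈ Finset.range (M + H), v t‖ ^ 2 ≤
      (M + H) * ∑ t ∈ Finset.range (M + H), ‖v t‖ ^ 2 := by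
    have h1 := sq_sum_le_card_mul_sum_sq (s := Finset.range (M + H)) (f := fun t => ‖v t‖)
    rw [Finset.card_range] at h1
    push_cast at h1
    refine le_trans ?_ h1
    gcongr
    exact norm_sum_le _ _
  have hsq : ∑ t ∈ Finset.range (M + H), ‖v t‖ ^ 2 ≤ H * M + H ^ 2 * B := by
    have h1 : ((∑ t ∈ Finset.range (M + H), ‖v t‖ ^ 2 : ℝ) : ℂ) =
        ∑ h ∈ Finset.range H, ∑ h' ∈ Finset.range H,
          ∑ t ∈ Finset.range (M + H), w t h * starRingEnd ℂ (w t h') := by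
      push_cast
      rw [Finset.sum_congr rfl fun h _ => Finset.sum_comm, Finset.sum_comm]
      refine Finset.sum_congr rfl fun t _ => ?_
      rw [← Complex.mul_conj']
      simp only [hv]
      rw [map_sum, Finset.sum_mul_sum]
    have h2 : ∑ t ∈ Finset.range (M + H), ‖v t‖ ^ 2 =
        ‖((∑ t ∈ Finset.range (M + H), ‖v t‖ ^ 2 : ℝ) : ℂ)‖ := by
      rw [Complex.norm_real, Real.norm_of_nonneg (by positivity)]
    rw [h2, h1]
    calc _ ≤ ∑ h ∈ Finset.range H, ∑ h' ∈ Finset.range H,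
          ((if h = h' then (M : ℝ) else 0) + B) := by
          refine (norm_sum_le _ _).trans (Finset.sum_le_sum fun h hh => ?_)
          exact (norm_sum_le _ _).trans (Finset.sum_le_sum fun h' hh' => hcor' h hh h' hh')
      _ = H * M + H ^ 2 * B := by
          have : ∀ h ∈ Finset.range H, ∑ h' ∈ Finset.range H,
              ((if h = h' then (M : ℝ) else 0) + B) = M + H * B := by
            intro h hh
            rw [Finset.sum_add_distrib, Finset.sum_ite_eq, if_pos hh]
            simp
          rw [Finset.sum_congr rfl this]
          simp; ring
  have hH0 : (0 : ℝ) < H := by exact_mod_cast hH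
  have h3 : (H : ℝ) ^ 2 * ‖∑ n ∈ Finset.range M, z n‖ ^ 2 ≤
      (M + H) * (H * M + H ^ 2 * B) := by
    calc _ = ‖(H : ℂ) * ∑ n ∈ Finset.range M, z n‖ ^ 2 := by
          rw [norm_mul, mul_pow]; simp
      _ ≤ (M + H) * ∑ t ∈ Finset.range (M + H), ‖v t‖ ^ 2 := by rw [hHS]; exact hCS
      _ ≤ _ := by gcongr
  have h4 : ((M : ℝ) + H) * (H * M + H ^ 2 * B) = (H : ℝ) ^ 2 * ((M + H) * (M / H + B)) := by
    field_simp
  rw [h4] at h3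
  exact le_of_mul_le_mul_left h3 (by positivity)

/-- Iterated differences of a sequence with the given list of shifts. -/
def iterDiff : List ℕ → (ℕ → ℝ) → ℕ → ℝ
  | [], f => f
  | h :: hs, f => iterDiff hs fun n => f (n + h) - f n

/-- Iterated van der Corput differencing. -/
lemma norm_sum_unitExp_le_of_iterDiff (r : ℕ) (f : ℕ → ℝ) {X : ℝ} {H : ℕ} (hH : 1 ≤ H)
    (hHX : (H : ℝ) ≤ X) {M₀ : ℕ} (hM₀ : (M₀ : ℝ) ≤ X)
    (hf : ∀ hs : List ℕ, hs.length = r → (∀ h ∈ hs, 1 ≤ h ∧ h < H) → ∀ M ≤ M₀,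
      ‖∑ n ∈ Finset.range M, unitExp (iterDiff hs f n)‖ ≤ 6 * X / H) (M : ℕ) (hM : M ≤ M₀) :
    ‖∑ n ∈ Finset.range M, unitExp (f n)‖ ≤ 6 * X * ((H : ℝ)⁻¹) ^ ((1 / 2 : ℝ) ^ r) := by
  have hH0 : (0 : ℝ) < H := by exact_mod_cast hH
  have hX0 : 0 < X := hH0.trans_le hHX
  induction r generalizing f M with
  | zero =>
    have := hf [] rfl (by simp) M hM
    simpa [iterDiff, div_eq_mul_inv] using this
  | succ r ih =>
    set κ : ℝ := (1 / 2 : ℝ) ^ r with hκ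
    have hκ1 : κ ≤ 1 := pow_le_one₀ (by norm_num) (by norm_num)
    have hinv1 : (H : ℝ)⁻¹ ≤ 1 := inv_le_one_of_one_le₀ (by exact_mod_cast hH)
    set ε : ℝ := ((H : ℝ)⁻¹) ^ κ with hε
    have hε0 : 0 < ε := by positivity
    have hB : ∀ h, 1 ≤ h → h < H → ‖∑ n ∈ Finset.range (M - h),
        unitExp (f (n + h)) * starRingEnd ℂ (unitExp (f n))‖ ≤ 6 * X * ε := by
      intro h h1 h2
      simp only [← unitExp_sub]
      refine ih (fun n => f (n + h) - f n) (fun hs hl hhs M' hM' => ?_) (M - h) (by omega)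
      refine hf (h :: hs) (by simp [hl]) ?_ M' hM'
      intro k hk
      rcases List.mem_cons.1 hk with rfl | hk
      · exact ⟨h1, h2⟩
      · exact hhs k hk
    have h1 := norm_sum_sq_le_of_correlations (fun n => unitExp (f n)) M H hH
      (fun n => (norm_unitExp _).le) (by positivity) hB
    have h2 : (H : ℝ)⁻¹ ≤ ε := by
      calc (H : ℝ)⁻¹ = ((H : ℝ)⁻¹) ^ (1 : ℝ) := (Real.rpow_one _).symm
        _ ≤ ε := Real.rpow_le_rpow_of_exponent_ge (by positivity) hinv1 hκ1
    have hMX : (M : ℝ) ≤ X := le_trans (by exact_mod_cast hM) hM₀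
    have h3 : ((M : ℝ) + H) * (M / H + 6 * X * ε) ≤ (6 * X) ^ 2 * ε := by
      have h4 : (M : ℝ) / H ≤ X * ε := by
        rw [div_eq_mul_inv]; gcongr
      -- The constant `6` reproduces itself under the recursion because `2 * (1 + 6) ≤ 6 ^ 2`.
      calc _ ≤ (X + X) * (X * ε + 6 * X * ε) := by gcongr
        _ = 14 * (X ^ 2 * ε) := by ring
        _ ≤ 36 * (X ^ 2 * ε) := by gcongr; norm_num
        _ = _ := by ring
    have h5 : (((H : ℝ)⁻¹) ^ ((1 / 2 : ℝ) ^ (r + 1))) ^ 2 = ε := by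
      rw [hε, ← Real.rpow_natCast, ← Real.rpow_mul (by positivity), hκ]
      congr 1
      rw [pow_succ]; push_cast; ring
    refine (sq_le_sq₀ (norm_nonneg _) (by positivity)).1 ?_
    rw [mul_pow, h5]
    exact h1.trans h3

/-! ### Iterated differences and the derivatives of `γ x ^ c`. -/

/-- Mean value bound for iterated differences along an arithmetic progression. -/
lemma le_iterDiff_of_le_deriv (hs : List ℕ) (F : ℕ → ℝ → ℝ) {a b lo x₀ : ℝ} {D : ℕ}
    (hD : 1 ≤ D) (hhs : ∀ h ∈ hs, 1 ≤ h)
    (hF : ∀ i x, a ≤ x → HasDerivAt (F i) (F (i + 1) x) x)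
    (hlo : ∀ x, a ≤ x → x ≤ b → lo ≤ F hs.length x) (hx : a ≤ x₀) (n : ℕ)
    (hn : x₀ + D * (n + hs.sum : ℕ) ≤ b) :
    (D : ℝ) ^ hs.length * (hs.prod : ℕ) * lo ≤ iterDiff hs (fun n => F 0 (x₀ + D * n)) n := by
  induction hs generalizing F b lo with
  | nil =>
    simp only [List.length_nil, pow_zero, List.prod_nil, Nat.cast_one, one_mul, iterDiff]
    simp only [List.sum_nil, add_zero] at hn
    exact hlo _ (by have : (0 : ℝ) ≤ D * n := by positivity
                    linarith) hn
  | cons h hs ih =>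
    have hh : 1 ≤ h := hhs h (by simp)
    have hd0 : (0 : ℝ) < D * h := by
      have : 0 < D * h := Nat.mul_pos hD hh
      exact_mod_cast this
    -- One difference with shift `D * h` acts on the whole chain of derivatives. By the mean value
    -- theorem it gains a factor `D * h` in the lower bound, while the interval shrinks by `D * h`.
    have key := ih (F := fun i x => F i (x + D * h) - F i x) (b := b - D * h) (lo := D * h * lo)
      (fun k hk => hhs k (by simp [hk])) ?_ ?_ ?_
    · have e1 : (fun n : ℕ => F 0 (x₀ + D * n + D * h) - F 0 (x₀ + D * n)) =
          fun n : ℕ => F 0 (x₀ + D * (n + h : ℕ)) - F 0 (x₀ + D * n) := by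
        funext n; push_cast; ring_nf
      simp only [e1] at key
      simp only [iterDiff, List.length_cons, List.prod_cons]
      refine le_trans (le_of_eq ?_) key
      push_cast; ring
    · intro i x hx
      have h1 : HasDerivAt (fun x => F i (x + D * h)) (F (i + 1) (x + D * h)) x :=
        (hF i (x + D * h) (by linarith)).comp_add_const x (D * h)
      exact h1.sub (hF i x hx)
    · intro x hx1 hx2
      obtain ⟨ξ, hξ, hξe⟩ := exists_hasDerivAt_eq_slope (F hs.length) (F (hs.length + 1))
        (a := x) (b := x + D * h) (by linarith)
        (fun y hy => (hF _ y (hx1.trans hy.1)).continuousAt.continuousWithinAt)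
        (fun y hy => hF _ y (hx1.trans hy.1.le))
      have h2 : lo ≤ F (hs.length + 1) ξ :=
        hlo ξ (hx1.trans hξ.1.le) (by linarith [hξ.2])
      rw [hξe, add_sub_cancel_left, le_div_iff₀ hd0] at h2
      linarith
    · have e : ((n + (h :: hs).sum : ℕ) : ℝ) = (n + hs.sum : ℕ) + h := by
        rw [List.sum_cons]; push_cast; ring
      rw [e] at hn
      linarith

lemma iterDiff_neg (hs : List ℕ) (f : ℕ → ℝ) (n : ℕ) :
    iterDiff hs (fun n => -f n) n = -iterDiff hs f n := by
  induction hs generalizing f with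
  | nil => rfl
  | cons h hs ih =>
    simp only [iterDiff]
    rw [← ih]
    congr 1
    funext n; ring

lemma iterDiff_append_singleton (hs : List ℕ) (h : ℕ) (f : ℕ → ℝ) (n : ℕ) :
    iterDiff (hs ++ [h]) f n = iterDiff hs f (n + h) - iterDiff hs f n := by
  induction hs generalizing f with
  | nil => rfl
  | cons k hs ih => simp only [List.cons_append, iterDiff]; rw [ih]

lemma iterDiff_le_of_deriv_le (hs : List ℕ) (F : ℕ → ℝ → ℝ) {a b hi x₀ : ℝ} {D : ℕ}
    (hD : 1 ≤ D) (hhs : ∀ h ∈ hs, 1 ≤ h)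
    (hF : ∀ i x, a ≤ x → HasDerivAt (F i) (F (i + 1) x) x)
    (hhi : ∀ x, a ≤ x → x ≤ b → F hs.length x ≤ hi) (hx : a ≤ x₀) (n : ℕ)
    (hn : x₀ + D * (n + hs.sum : ℕ) ≤ b) :
    iterDiff hs (fun n => F 0 (x₀ + D * n)) n ≤ (D : ℝ) ^ hs.length * (hs.prod : ℕ) * hi := by
  have := le_iterDiff_of_le_deriv hs (fun i x => -F i x) (lo := -hi) hD hhs
    (fun i x hx => (hF i x hx).neg) (fun x h1 h2 => neg_le_neg (hhi x h1 h2)) hx n hn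
  rw [iterDiff_neg hs (fun n => F 0 (x₀ + D * n))] at this
  linarith

/-- The `i`-th derivative of `γ x ^ c`. -/
noncomputable def powDeriv (γ c : ℝ) (i : ℕ) (x : ℝ) : ℝ :=
  γ * (∏ j ∈ Finset.range i, (c - j)) * x ^ (c - i)

lemma hasDerivAt_powDeriv (γ c : ℝ) (i : ℕ) {x : ℝ} (hx : 0 < x) :
    HasDerivAt (powDeriv γ c i) (powDeriv γ c (i + 1) x) x := by
  have h : HasDerivAt (powDeriv γ c i) _ x :=
    (Real.hasDerivAt_rpow_const (x := x) (p := c - i) (Or.inl hx.ne')).const_mul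
      (γ * ∏ j ∈ Finset.range i, (c - j))
  refine h.congr_deriv ?_
  rw [powDeriv, Finset.prod_range_succ, show c - ((i + 1 : ℕ) : ℝ) = c - i - 1 by push_cast; ring]
  ring

lemma pow_le_prod_sub {c δ : ℝ} {s : ℕ} (hδ : 0 < δ) (h1 : s + δ ≤ c) :
    δ ^ (s + 1) ≤ ∏ j ∈ Finset.range (s + 1), (c - j) := by
  calc δ ^ (s + 1) = ∏ j ∈ Finset.range (s + 1), δ := by simp
    _ ≤ _ := by
      refine Finset.prod_le_prod (fun _ _ => hδ.le) fun j hj => ?_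
      have : (j : ℝ) ≤ s := by
        exact_mod_cast Nat.lt_succ_iff.1 (Finset.mem_range.1 hj)
      linarith

lemma prod_sub_le_pow {c δ : ℝ} {s : ℕ} (hδ : 0 < δ) (h1 : s + δ ≤ c) (h2 : c ≤ s + 1 - δ) :
    ∏ j ∈ Finset.range (s + 1), (c - j) ≤ ((s : ℝ) + 1) ^ (s + 1) := by
  calc _ ≤ ∏ j ∈ Finset.range (s + 1), ((s : ℝ) + 1) := by
        refine Finset.prod_le_prod (fun j hj => ?_) fun j _ => ?_
        · have : (j : ℝ) ≤ s := by
            exact_mod_cast Nat.lt_succ_iff.1 (Finset.mem_range.1 hj)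
          linarith
        · have : (0 : ℝ) ≤ j := Nat.cast_nonneg j
          linarith
    _ = _ := by simp

section powDerivBounds

variable {c δ γ X Q x : ℝ} {s : ℕ}

/-- The exponent `c - (s + 1)` lies in `[-1, 0]`, so allowing `x` up to `2 * X` loses at most a
factor `2`; every factor `c - j` of the coefficient is at least `δ`. -/
lemma le_powDeriv (hδ : 0 < δ) (h1 : s + δ ≤ c) (h2 : c ≤ s + 1 - δ) (hQ : 1 ≤ Q)
    (hγ : 1 / Q ≤ γ) (hX : 0 < X) (hx0 : 0 < x) (hx : x ≤ 2 * X) :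
    δ ^ (s + 1) * X ^ (c - (s + 1)) / (2 * Q) ≤ powDeriv γ c (s + 1) x := by
  have hp := pow_le_prod_sub hδ h1
  have e1 : X ^ (c - (s + 1)) / 2 ≤ x ^ (c - (s + 1)) := by
    calc X ^ (c - (s + 1)) / 2 = (2 : ℝ) ^ (-1 : ℝ) * X ^ (c - (s + 1)) := by
          rw [Real.rpow_neg_one]; ring
      _ ≤ (2 : ℝ) ^ (c - (s + 1)) * X ^ (c - (s + 1)) := by
          gcongr
          · norm_num
          · linarith
      _ = (2 * X) ^ (c - (s + 1)) := by rw [Real.mul_rpow (by norm_num) hX.le]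
      _ ≤ x ^ (c - (s + 1)) := Real.rpow_le_rpow_of_nonpos hx0 hx (by linarith)
  have e2 : δ ^ (s + 1) * X ^ (c - (s + 1)) / (2 * Q) =
      1 / Q * δ ^ (s + 1) * (X ^ (c - (s + 1)) / 2) := by
    field_simp
  rw [e2, powDeriv]
  push_cast
  have hγ0 : 0 < γ := lt_of_lt_of_le (by positivity) hγ
  have hp0 : 0 ≤ ∏ j ∈ Finset.range (s + 1), (c - j) := le_trans (by positivity) hp
  gcongr

/-- For a negative exponent, descending from `X` to `X / Q` costs only a power of `Q`; this is why
the range of summation starts at `X / Q`. -/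
lemma rpow_div_le {p : ℝ} {k : ℕ} (hX : 0 < X) (hQ : 1 ≤ Q) (hx : X / Q ≤ x) (hp : p ≤ 0)
    (hk : -p ≤ k) : x ^ p ≤ Q ^ k * X ^ p := by
  have hQ0 : 0 < Q := by linarith
  calc x ^ p ≤ (X / Q) ^ p := Real.rpow_le_rpow_of_nonpos (by positivity) hx hp
    _ = Q ^ (-p) * X ^ p := by
      rw [Real.div_rpow hX.le hQ0.le, Real.rpow_neg hQ0.le]; field_simp
    _ ≤ Q ^ (k : ℝ) * X ^ p := by gcongr
    _ = _ := by rw [Real.rpow_natCast]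

lemma powDeriv_le (hδ : 0 < δ) (h1 : s + δ ≤ c) (h2 : c ≤ s + 1 - δ) (hQ : 1 ≤ Q)
    (hγ : γ ≤ 1) (hX : 0 < X) (hx : X / Q ≤ x) :
    powDeriv γ c (s + 1) x ≤ ((s : ℝ) + 1) ^ (s + 1) * (Q * X ^ (c - (s + 1))) := by
  have hp := prod_sub_le_pow hδ h1 h2
  have hp0 : 0 ≤ ∏ j ∈ Finset.range (s + 1), (c - j) :=
    (by positivity : 0 ≤ δ ^ (s + 1)).trans (pow_le_prod_sub hδ h1)
  have hx0 : 0 < x := lt_of_lt_of_le (by positivity) hx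
  have e1 := rpow_div_le (p := c - (s + 1)) (k := 1) hX hQ hx (by linarith)
    (by push_cast; linarith)
  rw [pow_one] at e1
  rw [powDeriv]
  push_cast
  calc _ ≤ 1 * ((s : ℝ) + 1) ^ (s + 1) * (Q * X ^ (c - (s + 1))) := by gcongr
    _ = _ := by rw [one_mul]

lemma abs_powDeriv_succ_le (hδ : 0 < δ) (h1 : s + δ ≤ c) (h2 : c ≤ s + 1 - δ) (hQ : 1 ≤ Q)
    (hγ0 : 0 ≤ γ) (hγ : γ ≤ 1) (hX : 0 < X) (hx : X / Q ≤ x) :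
    |powDeriv γ c (s + 2) x| ≤ ((s : ℝ) + 1) ^ (s + 1) * (Q ^ 2 * (X ^ (c - (s + 1)) / X)) := by
  have hp := prod_sub_le_pow hδ h1 h2
  have hp0 : 0 ≤ ∏ j ∈ Finset.range (s + 1), (c - j) :=
    (by positivity : 0 ≤ δ ^ (s + 1)).trans (pow_le_prod_sub hδ h1)
  have hx0 : 0 < x := lt_of_lt_of_le (by positivity) hx
  have e1 := rpow_div_le (p := c - (s + 1) - 1) (k := 2) hX hQ hx (by linarith)
    (by push_cast; linarith)
  rw [Real.rpow_sub_one hX.ne'] at e1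
  have e2 : |c - ((s + 1 : ℕ) : ℝ)| ≤ 1 := by
    push_cast
    rw [abs_le]; constructor <;> linarith
  rw [powDeriv, Finset.prod_range_succ, abs_mul, abs_mul, abs_mul, abs_of_nonneg hγ0,
    abs_of_nonneg hp0, abs_of_nonneg (Real.rpow_nonneg hx0.le _),
    show c - ((s + 2 : ℕ) : ℝ) = c - (s + 1) - 1 by push_cast; ring]
  calc _ ≤ 1 * (((s : ℝ) + 1) ^ (s + 1) * 1) * (Q ^ 2 * (X ^ (c - (s + 1)) / X)) := by gcongr
    _ = _ := by ring

end powDerivBounds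

/-! ### Power saving for exponential sums of `n ^ c`. -/

set_option maxHeartbeats 1000000 in
/-- Power saving for exponential sums of `γ x ^ c` along an arithmetic progression. -/
theorem norm_sum_unitExp_rpow_le {c δ γ X Q x₀ : ℝ} {s D H M₀ : ℕ} (hδ : 0 < δ) (hδ1 : δ ≤ 1)
    (h1 : s + δ ≤ c) (h2 : c ≤ s + 1 - δ) (hD : 1 ≤ D) (hDQ : (D : ℝ) ≤ Q) (hH : 1 ≤ H)
    (hHQ : (H : ℝ) ≤ Q) (hγ1 : 1 / Q ≤ γ) (hγ2 : γ ≤ 1) (hX1 : 1 ≤ X) (hx₀ : X / Q ≤ x₀)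
    (hDx : (D : ℝ) ≤ x₀)
    (hbig : 4 * (Q ^ (2 * s + 7) * ((s : ℝ) + 1) ^ (s + 1) * (1 / δ) ^ (2 * (s + 1))) ≤ X ^ δ)
    (hM₀ : x₀ + D * M₀ ≤ X + D) :
    ‖∑ n ∈ Finset.range M₀, unitExp (γ * (x₀ + D * n) ^ c)‖ ≤
      6 * X * ((H : ℝ)⁻¹) ^ ((1 / 2 : ℝ) ^ s) := by
  have hD1 : (1 : ℝ) ≤ D := by exact_mod_cast hD
  have hH1 : (1 : ℝ) ≤ H := by exact_mod_cast hH
  have hQ1 : 1 ≤ Q := hD1.trans hDQ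
  have hQ0 : 0 < Q := by linarith
  have hX0 : 0 < X := by linarith
  have ha : 0 < X / Q := by positivity
  have hx0 : 0 < x₀ := ha.trans_le hx₀
  have hγ0 : 0 < γ := lt_of_lt_of_le (by positivity) hγ1
  set S : ℝ := ((s : ℝ) + 1) ^ (s + 1) with hS
  have hS1 : (s : ℝ) + 1 ≤ S := le_self_pow₀ (by linarith [(Nat.cast_nonneg s : (0 : ℝ) ≤ s)])
    (by omega)
  have hs0 : (0 : ℝ) ≤ s := Nat.cast_nonneg s
  set A : ℝ := (1 / δ) ^ (s + 1) with hA
  have hA1 : 1 ≤ A := one_le_pow₀ (by rw [le_div_iff₀ hδ]; linarith)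
  have hA2 : (1 / δ) ^ (2 * (s + 1)) = A ^ 2 := by rw [hA, ← pow_mul]; congr 1; ring
  rw [hA2] at hbig
  set Y : ℝ := X ^ δ with hY
  have hY0 : 0 < Y := by positivity
  have hYX : Y ≤ X := by
    calc Y ≤ X ^ (1 : ℝ) := Real.rpow_le_rpow_of_exponent_le hX1 hδ1
      _ = X := Real.rpow_one X
  set L : ℝ := X ^ (c - (s + 1)) with hL
  have hL0 : 0 < L := by positivity
  -- This bound and the next one use the two sides of the condition on `c`: `L ≤ X ^ (-δ)` keeps the
  -- increments below `1 / 2`, and `L ≥ X ^ (δ - 1)` makes `1 / L` smaller than `X` by a power.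
  have hLY : L * Y ≤ 1 := by
    rw [hL, hY, ← Real.rpow_add hX0]
    exact Real.rpow_le_one_of_one_le_of_nonpos hX1 (by linarith)
  have hLX : Y ≤ L * X := by
    have : L * X = X ^ (c - (s + 1) + 1) := by rw [Real.rpow_add_one hX0.ne']
    rw [this]
    exact Real.rpow_le_rpow_of_exponent_le hX1 (by linarith)
  have hA2' : 1 ≤ A ^ 2 := one_le_pow₀ hA1
  have hbig1 : 4 * (Q ^ (2 * s + 7) * S) ≤ Y := by
    refine le_trans ?_ hbig
    exact mul_le_mul_of_nonneg_left (le_mul_of_one_le_right (by positivity) hA2') (by norm_num)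
  have hQX : Q * (s * Q + 3) ≤ X := by
    refine le_trans ?_ (hbig1.trans hYX)
    calc Q * (s * Q + 3) ≤ Q * (s * Q + 3 * Q) := by gcongr; linarith
      _ = Q ^ 2 * (s + 3) := by ring
      _ ≤ Q ^ (2 * s + 7) * (3 * S) := by
          gcongr
          · omega
          · linarith
      _ ≤ 4 * (Q ^ (2 * s + 7) * S) := by
          have : 0 ≤ Q ^ (2 * s + 7) * S := by positivity
          linarith
  have hHX : (H : ℝ) ≤ X := by
    have := mul_nonneg hs0 hQ0.le
    nlinarith
  have hM₀X : (M₀ : ℝ) ≤ X := by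
    have : (M₀ : ℝ) ≤ D * M₀ := le_mul_of_one_le_left (Nat.cast_nonneg _) hD1
    linarith
  refine norm_sum_unitExp_le_of_iterDiff s _ hH hHX hM₀X (fun hs hl hhs M hM => ?_) M₀ le_rfl
  have hhs1 : ∀ h ∈ hs, 1 ≤ h := fun h hh => (hhs h hh).1
  have hprod1 : (1 : ℝ) ≤ (hs.prod : ℕ) := by
    exact_mod_cast List.one_le_prod_of_one_le hhs1
  have hprodQ : ((hs.prod : ℕ) : ℝ) ≤ Q ^ s := by
    have h3 : hs.prod ≤ H ^ hs.length := List.prod_le_pow_card hs H fun h hh => (hhs h hh).2.le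
    rw [hl] at h3
    calc ((hs.prod : ℕ) : ℝ) ≤ (H : ℝ) ^ s := by exact_mod_cast h3
      _ ≤ Q ^ s := by gcongr
  have hsumH : ((hs.sum : ℕ) : ℝ) ≤ s * Q := by
    have h3 : hs.sum ≤ hs.length • H := List.sum_le_card_nsmul hs H fun h hh => (hhs h hh).2.le
    rw [hl, smul_eq_mul] at h3
    calc ((hs.sum : ℕ) : ℝ) ≤ s * H := by exact_mod_cast h3
      _ ≤ s * Q := by gcongr
  set F : ℕ → ℝ → ℝ := powDeriv γ c with hF
  have hf : (fun n : ℕ => γ * (x₀ + D * n) ^ c) = fun n : ℕ => F 0 (x₀ + D * n) := by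
    funext n; simp [hF, powDeriv]
  have hderiv : ∀ i x, X / Q ≤ x → HasDerivAt (F i) (F (i + 1) x) x :=
    fun i x hx => hasDerivAt_powDeriv γ c i (ha.trans_le hx)
  -- The shifts and two further steps, needed for second increments, carry the argument slightly
  -- past `X`, but not past `2 * X`.
  have hrange : ∀ n ≤ M, x₀ + D * (n + (hs.sum + 2) : ℕ) ≤ 2 * X := by
    intro n hn
    have h4 : (n : ℝ) ≤ M₀ := by exact_mod_cast hn.trans hM
    have h5 : (D : ℝ) * n ≤ D * M₀ := by gcongr
    have h6 : (D : ℝ) * (hs.sum + 3) ≤ Q * (s * Q + 3) := by gcongr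
    push_cast at h6 ⊢
    linarith
  rw [hf]
  set g : ℕ → ℝ := iterDiff hs fun n : ℕ => F 0 (x₀ + D * n) with hg
  -- Increments of the differenced phase are iterated differences with an extra shift `1`, so the
  -- first and second increments are governed by the derivatives of order `s + 1` and `s + 2`.
  have hg1 : ∀ n, g (n + 1) - g n = iterDiff (hs ++ [1]) (fun n : ℕ => F 0 (x₀ + D * n)) n :=
    fun n => (iterDiff_append_singleton hs 1 _ n).symm
  have hg2 : ∀ n, (g (n + 2) - g (n + 1)) - (g (n + 1) - g n) =
      iterDiff (hs ++ [1] ++ [1]) (fun n : ℕ => F 0 (x₀ + D * n)) n := fun n => by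
    rw [iterDiff_append_singleton, ← hg1, ← hg1]
  have hl1 : (hs ++ [1]).length = s + 1 := by simp [hl]
  have hl2 : (hs ++ [1] ++ [1]).length = s + 2 := by simp [hl]
  have hhs1' : ∀ h ∈ hs ++ [1], 1 ≤ h := by
    intro h hh
    simp only [List.mem_append, List.mem_singleton] at hh
    rcases hh with hh | rfl
    · exact hhs1 h hh
    · exact le_rfl
  have hhs2' : ∀ h ∈ hs ++ [1] ++ [1], 1 ≤ h := by
    intro h hh
    rw [List.mem_append, List.mem_singleton] at hh
    rcases hh with hh | rfl
    · exact hhs1' h hh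
    · exact le_rfl
  have hp1 : (hs ++ [1]).prod = hs.prod := by simp
  have hp2 : (hs ++ [1] ++ [1]).prod = hs.prod := by simp
  have hD1s : (1 : ℝ) ≤ (D : ℝ) ^ (s + 1) := one_le_pow₀ hD1
  have hDQs : ∀ k, (D : ℝ) ^ k ≤ Q ^ k := fun k => by gcongr
  have hr1 : ∀ n ≤ M, x₀ + D * (n + (hs ++ [1]).sum : ℕ) ≤ 2 * X := by
    intro n hn
    refine le_trans ?_ (hrange n hn)
    gcongr
    simp
  have hr2 : ∀ n ≤ M, x₀ + D * (n + (hs ++ [1] ++ [1]).sum : ℕ) ≤ 2 * X := by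
    intro n hn
    refine le_trans (le_of_eq ?_) (hrange n hn)
    simp
  set l : ℝ := δ ^ (s + 1) * L / (2 * Q) with hldef
  have hl0 : 0 < l := by positivity
  set μ : ℝ := Q ^ (s + 2) * Q ^ s * (S * (Q ^ 2 * (L / X))) with hμ
  have hlow : ∀ n ≤ M, l ≤ g (n + 1) - g n := by
    intro n hn
    have h3 := le_iterDiff_of_le_deriv (hs ++ [1]) F (lo := l) hD hhs1' hderiv
      (fun x hx1 hx2 => by
        rw [hl1]; exact le_powDeriv hδ h1 h2 hQ1 hγ1 hX0 (ha.trans_le hx1) hx2) hx₀ n (hr1 n hn)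
    rw [← hg1, hl1, hp1] at h3
    refine le_trans ?_ h3
    exact le_mul_of_one_le_left hl0.le (one_le_mul_of_one_le_of_one_le hD1s hprod1)
  have hup : ∀ n ≤ M, g (n + 1) - g n ≤ 1 / 2 := by
    intro n hn
    have h3 := iterDiff_le_of_deriv_le (hs ++ [1]) F (hi := S * (Q * L)) hD hhs1' hderiv
      (fun x hx1 _ => by
        rw [hl1]; exact powDeriv_le hδ h1 h2 hQ1 hγ2 hX0 hx1) hx₀ n (hr1 n hn)
    rw [← hg1, hl1, hp1] at h3
    refine h3.trans ?_
    calc (D : ℝ) ^ (s + 1) * (hs.prod : ℕ) * (S * (Q * L)) ≤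
          Q ^ (s + 1) * Q ^ s * (S * (Q * L)) := by
          gcongr
      _ = Q ^ (2 * s + 2) * S * L := by ring
      _ ≤ Q ^ (2 * s + 7) * S * L := by
          gcongr
          omega
      _ ≤ Y / 4 * L := by gcongr; linarith
      _ ≤ 1 / 2 := by linarith
  have hsec : ∀ n < M, |(g (n + 2) - g (n + 1)) - (g (n + 1) - g n)| ≤ μ := by
    intro n hn
    have hb : ∀ x, X / Q ≤ x → |F (s + 2) x| ≤ S * (Q ^ 2 * (L / X)) := fun x hx =>
      abs_powDeriv_succ_le hδ h1 h2 hQ1 hγ0.le hγ2 hX0 hx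
    have h3 := iterDiff_le_of_deriv_le (hs ++ [1] ++ [1]) F (hi := S * (Q ^ 2 * (L / X))) hD hhs2'
      hderiv (fun x hx1 _ => by rw [hl2]; exact (abs_le.1 (hb x hx1)).2) hx₀ n (hr2 n hn.le)
    have h4 := le_iterDiff_of_le_deriv (hs ++ [1] ++ [1]) F (lo := -(S * (Q ^ 2 * (L / X)))) hD
      hhs2' hderiv (fun x hx1 _ => by rw [hl2]; exact (abs_le.1 (hb x hx1)).1) hx₀ n (hr2 n hn.le)
    rw [← hg2, hl2, hp2] at h3 h4
    have h5 : (D : ℝ) ^ (s + 2) * (hs.prod : ℕ) * (S * (Q ^ 2 * (L / X))) ≤ μ := by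
      rw [hμ]
      gcongr
    rw [abs_le]
    constructor <;> linarith
  refine (norm_sum_unitExp_le_of_increments g M hl0 hlow hup hsec).trans ?_
  have hMX : (M : ℝ) ≤ X := le_trans (by exact_mod_cast hM) hM₀X
  have hδA : δ ^ (s + 1) = 1 / A := by rw [hA, one_div_pow, one_div_one_div]
  have e1 : 1 / l = 2 * (Q * A) / L := by
    rw [hldef, hδA]; field_simp
  -- The exponent `2 * s + 6` is `(s + 2) + s + 2` from `μ` and `2` from `l ^ 2`; one more factor
  -- `Q`, absorbing `H`, gives the `2 * s + 7` of `hbig`.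
  have e2 : X * μ / l ^ 2 = 4 * (Q ^ (2 * s + 6) * S * A ^ 2) / L := by
    rw [hμ, hldef, hδA]; field_simp; ring
  have hμ0 : 0 ≤ μ := by positivity
  have hW : Q * A ≤ Q ^ (2 * s + 6) * S * A ^ 2 := by
    calc Q * A = Q ^ 1 * 1 * A ^ 1 := by ring
      _ ≤ Q ^ (2 * s + 6) * S * A ^ 2 := by
        gcongr
        · omega
        · linarith
        · norm_num
  calc 1 / l + M * μ / l ^ 2 ≤ 1 / l + X * μ / l ^ 2 := by gcongr
    _ = (2 * (Q * A) + 4 * (Q ^ (2 * s + 6) * S * A ^ 2)) / L := by rw [e1, e2, add_div]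
    _ ≤ (6 * (Q ^ (2 * s + 6) * S * A ^ 2)) / L := by gcongr; linarith
    _ ≤ 6 * X / H := by
      rw [div_le_div_iff₀ hL0 (by linarith)]
      have h7 : Q ^ (2 * s + 6) * S * A ^ 2 * H ≤ Y := by
        calc _ ≤ Q ^ (2 * s + 6) * S * A ^ 2 * Q := by gcongr
          _ = Q ^ (2 * s + 7) * S * A ^ 2 := by ring
          _ ≤ Y := by
            have : 0 ≤ Q ^ (2 * s + 7) * S * A ^ 2 := by positivity
            linarith
      nlinarith

/-! ### The Fejér kernel and equidistribution in residue classes. -/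

/-- Orthogonality of the additive characters modulo `e`. -/
lemma sum_unitExp_mul_div (e : ℕ) (he : 1 ≤ e) (x : ℤ) :
    ∑ a ∈ Finset.range e, unitExp (a * x / e) = if (e : ℤ) ∣ x then (e : ℂ) else 0 := by
  have he0 : (e : ℝ) ≠ 0 := by exact_mod_cast (by omega : e ≠ 0)
  have hpow : ∀ a : ℕ, unitExp (a * x / e) = unitExp (x / e) ^ a := by
    intro a
    induction a with
    | zero => simp [unitExp_zero]
    | succ a ih =>
      rw [pow_succ, ← ih, ← unitExp_add]
      congr 1
      push_cast; ring
  split_ifs with h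
  · obtain ⟨k, rfl⟩ := h
    have : ∀ a ∈ Finset.range e, unitExp (a * ((e * k : ℤ) : ℝ) / e) = 1 := by
      intro a _
      rw [← unitExp_intCast (a * k)]
      congr 1
      push_cast
      field_simp
    rw [Finset.sum_congr rfl this]
    simp
  · rw [Finset.sum_congr rfl fun a _ => hpow a]
    have h1 : unitExp (x / e) ≠ 1 := by
      intro h1
      rw [unitExp, Complex.exp_eq_one_iff] at h1
      obtain ⟨n, hn⟩ := h1
      apply h
      have h2 : ((2 * Real.pi * (x / e) : ℝ) : ℂ) = ((n * (2 * Real.pi) : ℝ) : ℂ) := by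
        apply mul_right_cancel₀ Complex.I_ne_zero
        rw [hn]; push_cast; ring
      have h3 : 2 * Real.pi * (x / e) = n * (2 * Real.pi) := by exact_mod_cast h2
      have h4 : (x : ℝ) = e * n := by
        have hp := Real.pi_pos
        field_simp at h3
        linarith
      exact ⟨n, by exact_mod_cast h4⟩
    rw [geom_sum_eq h1, ← hpow, mul_div_cancel_left₀ _ he0, unitExp_intCast, sub_self, zero_div]

/-- A Fejér kernel of period `E`. -/
noncomputable def fejer (E J : ℕ) (t : ℝ) : ℝ :=
  ‖∑ j ∈ Finset.range J, unitExp (j * t / E)‖ ^ 2 / (J : ℝ) ^ 2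

lemma fejer_nonneg (E J : ℕ) (t : ℝ) : 0 ≤ fejer E J t := by unfold fejer; positivity

lemma fejer_add_mul {E J : ℕ} (hE : E ≠ 0) (t : ℝ) (k : ℤ) :
    fejer E J (t + E * k) = fejer E J t := by
  unfold fejer
  congr 3
  refine Finset.sum_congr rfl fun j _ => ?_
  have : (j : ℝ) * (t + E * k) / E = j * t / E + ((j * k : ℤ) : ℝ) := by
    have : (E : ℝ) ≠ 0 := by exact_mod_cast hE
    push_cast; field_simp
  rw [this, unitExp_add, unitExp_intCast, mul_one]

/-- With `E = 8 * J` all phases lie in `[0, π / 4]`, so each term has real part at least `√2 / 2`,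
whose square is `1 / 2`. -/
lemma half_le_fejer {E J : ℕ} (hJ : 1 ≤ J) (hE : E = 8 * J) {t : ℝ} (h0 : 0 ≤ t) (h1 : t < 1) :
    1 / 2 ≤ fejer E J t := by
  have hJ0 : (0 : ℝ) < J := by exact_mod_cast hJ
  have hEr : (E : ℝ) = 8 * J := by rw [hE]; push_cast; ring
  have hpi := Real.pi_pos
  have hre : J * (Real.sqrt 2 / 2) ≤ ‖∑ j ∈ Finset.range J, unitExp (j * t / E)‖ := by
    refine le_trans ?_ (Complex.re_le_norm _)
    rw [Complex.re_sum]
    calc (J : ℝ) * (Real.sqrt 2 / 2) = ∑ j ∈ Finset.range J, (Real.sqrt 2 / 2) := by simp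
      _ ≤ _ := by
        refine Finset.sum_le_sum fun j hj => ?_
        rw [Finset.mem_range] at hj
        have hjJ : (j : ℝ) ≤ J := by exact_mod_cast hj.le
        rw [unitExp, Complex.exp_ofReal_mul_I_re, ← Real.cos_pi_div_four]
        have hang : 2 * Real.pi * (j * t / E) ≤ Real.pi / 4 := by
          have : (j : ℝ) * t / E ≤ 1 / 8 := by
            rw [hEr, div_le_div_iff₀ (by positivity) (by norm_num)]
            have : (j : ℝ) * t ≤ J * 1 := by gcongr
            linarith
          nlinarith
        exact Real.cos_le_cos_of_nonneg_of_le_pi (by positivity) (by linarith) hang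
  unfold fejer
  rw [le_div_iff₀ (by positivity)]
  have hs : Real.sqrt 2 ^ 2 = 2 := Real.sq_sqrt (by norm_num)
  calc 1 / 2 * (J : ℝ) ^ 2 = (J * (Real.sqrt 2 / 2)) ^ 2 := by rw [mul_pow, div_pow, hs]; ring
    _ ≤ _ := by gcongr

lemma fejer_eq_sum (E J : ℕ) (t : ℝ) :
    (fejer E J t : ℂ) = (1 / (J : ℂ) ^ 2) * ∑ i ∈ Finset.range J, ∑ j ∈ Finset.range J,
      unitExp (((i : ℤ) - j : ℤ) * t / E) := by
  unfold fejer
  push_cast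
  rw [← Complex.mul_conj', map_sum, Finset.sum_mul_sum, div_eq_mul_inv, mul_comm, one_div]
  congr 1
  refine Finset.sum_congr rfl fun i _ => Finset.sum_congr rfl fun j _ => ?_
  rw [← unitExp_sub]
  congr 1
  ring

/-- Mean value of the Fejér kernel over a residue class, for points with small exponential sums. -/
lemma abs_sum_fejer_sub_le {ι : Type*} {E J e : ℕ} (hJ : 1 ≤ J) (hE : E = 8 * J) (he : 1 ≤ e)
    (heE : e ∣ E) (N : ℤ) (s : Finset ι) (y : ι → ℝ) {S : ℝ} (hS0 : 0 ≤ S)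
    (hS : ∀ h : ℤ, h ≠ 0 → |h| < e → ‖∑ k ∈ s, unitExp (h * y k / e)‖ ≤ S) :
    |∑ k ∈ s, ∑ m ∈ Finset.range E, (if (e : ℤ) ∣ N - m then fejer E J (y k - m) else 0) -
      8 * s.card / e| ≤ 8 * S := by
  obtain ⟨E', hE'⟩ := heE
  have hE1 : 1 ≤ E := by omega
  have hE'1 : 1 ≤ E' := by
    rcases Nat.eq_zero_or_pos E' with h | h
    · rw [h] at hE'; omega
    · exact h
  have hJc : (J : ℂ) ≠ 0 := by exact_mod_cast (by omega : J ≠ 0)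
  have hec : (e : ℂ) ≠ 0 := by exact_mod_cast (by omega : e ≠ 0)
  have her : (0 : ℝ) < e := by exact_mod_cast he
  have hJr : (0 : ℝ) < J := by exact_mod_cast hJ
  have hEr : (0 : ℝ) < E := by exact_mod_cast hE1
  have hE8 : (E : ℝ) = 8 * J := by rw [hE]; push_cast; ring
  have hEe : (E : ℝ) = e * E' := by rw [hE']; push_cast; ring
  have hE'r : (0 : ℝ) < E' := by exact_mod_cast hE'1
  set Z : ℤ → ℂ := fun i => ∑ k ∈ s, unitExp (i * y k / E) with hZ
  set U : ℕ → ℂ := fun a => (1 / (e * (J : ℂ) ^ 2)) * ∑ i ∈ Finset.range J, ∑ j ∈ Finset.range J,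
    (if (E : ℤ) ∣ -(a * E' + ((i : ℤ) - j)) then (E : ℂ) else 0) *
      (unitExp (a * N / e) * Z ((i : ℤ) - j)) with hU
  -- The congruence modulo `e` is detected by characters indexed by `a` and the kernel is expanded.
  -- Summation over `m` modulo `E` then forces `E ∣ a * E' + (i - j)`, where `E = e * E'`.
  have hT : ((∑ k ∈ s, ∑ m ∈ Finset.range E,
      (if (e : ℤ) ∣ N - m then fejer E J (y k - m) else 0) : ℝ) : ℂ) =
      ∑ a ∈ Finset.range e, U a := by
    have h1 : ∀ k ∈ s, ∀ m ∈ Finset.range E,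
        (((if (e : ℤ) ∣ N - m then fejer E J (y k - m) else 0 : ℝ)) : ℂ) =
        ∑ a ∈ Finset.range e, ∑ i ∈ Finset.range J, ∑ j ∈ Finset.range J,
          (1 / (e * (J : ℂ) ^ 2)) * (unitExp (m * ((-(a * E' + ((i : ℤ) - j)) : ℤ) : ℝ) / E) *
            (unitExp (a * N / e) * unitExp (((i : ℤ) - j : ℤ) * y k / E))) := by
      intro k _ m _
      have h2 : (((if (e : ℤ) ∣ N - m then fejer E J (y k - m) else 0 : ℝ)) : ℂ) =
          (1 / e) * (∑ a ∈ Finset.range e, unitExp (a * ((N - m : ℤ) : ℝ) / e)) *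
            fejer E J (y k - m) := by
        rw [sum_unitExp_mul_div e he]
        split_ifs
        · field_simp
        · simp
      rw [h2, fejer_eq_sum, Finset.mul_sum, Finset.sum_mul]
      refine Finset.sum_congr rfl fun a _ => ?_
      rw [Finset.mul_sum, Finset.mul_sum]
      refine Finset.sum_congr rfl fun i _ => ?_
      rw [Finset.mul_sum, Finset.mul_sum]
      refine Finset.sum_congr rfl fun j _ => ?_
      have h3 : unitExp (a * ((N - m : ℤ) : ℝ) / e) *
          unitExp (((i : ℤ) - j : ℤ) * (y k - m) / E) =
          unitExp (m * ((-(a * E' + ((i : ℤ) - j)) : ℤ) : ℝ) / E) *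
            (unitExp (a * N / e) * unitExp (((i : ℤ) - j : ℤ) * y k / E)) := by
        rw [← unitExp_add, ← unitExp_add, ← unitExp_add]
        congr 1
        rw [hEe]
        push_cast
        field_simp
        ring
      rw [← h3]
      field_simp
    simp only [Complex.ofReal_sum]
    rw [Finset.sum_congr rfl fun k hk => Finset.sum_congr rfl (h1 k hk)]
    rw [Finset.sum_congr rfl fun k _ => Finset.sum_comm, Finset.sum_comm]
    refine Finset.sum_congr rfl fun a _ => ?_
    simp only [hU]
    rw [Finset.sum_congr rfl fun k _ => Finset.sum_comm, Finset.sum_comm, Finset.mul_sum]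
    refine Finset.sum_congr rfl fun i _ => ?_
    rw [Finset.sum_congr rfl fun k _ => Finset.sum_comm, Finset.sum_comm, Finset.mul_sum]
    refine Finset.sum_congr rfl fun j _ => ?_
    rw [← sum_unitExp_mul_div E hE1, hZ, Finset.mul_sum, Finset.sum_mul_sum, Finset.sum_comm,
      Finset.mul_sum]
    refine Finset.sum_congr rfl fun m _ => ?_
    rw [Finset.mul_sum]
  -- For `a = 0` only the diagonal `i = j` survives, because `|i - j| < J ≤ E`.
  have hU0 : U 0 = 8 * s.card / e := by
    have h1 : ∀ i ∈ Finset.range J, ∑ j ∈ Finset.range J,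
        (if (E : ℤ) ∣ -((0 : ℕ) * E' + ((i : ℤ) - j)) then (E : ℂ) else 0) *
          (unitExp ((0 : ℕ) * N / e) * Z ((i : ℤ) - j)) = E * s.card := by
      intro i hi
      rw [Finset.sum_eq_single i]
      · simp [unitExp_zero, hZ]
      · intro j hj hji
        rw [if_neg, zero_mul]
        rw [Finset.mem_range] at hi hj
        intro hd
        have h0 : -(((0 : ℕ) : ℤ) * E' + ((i : ℤ) - j)) = j - i := by push_cast; ring
        rw [h0] at hd
        have := Int.eq_zero_of_abs_lt_dvd hd (by rw [abs_lt]; constructor <;> omega)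
        omega
      · intro h; exact absurd hi h
    simp only [hU]
    rw [Finset.sum_congr rfl h1, Finset.sum_const, Finset.card_range, nsmul_eq_mul]
    have : (E : ℂ) = 8 * J := by exact_mod_cast hE8
    rw [this]
    field_simp
  -- For `0 < a < e` the divisibility gives `i - j = E' * h` with `h ≡ -a` modulo `e`, hence `h ≠
  -- 0`, and `|h| < e`. The frequency `(i - j) / E` is then `h / e`. Each `i` admits at most one
  -- `j`, so the bound does not depend on the size of `E`.
  have hUa : ∀ a ∈ (Finset.range e).erase 0, ‖U a‖ ≤ 8 * S / e := by
    intro a ha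
    rw [Finset.mem_erase, Finset.mem_range] at ha
    simp only [hU]
    rw [norm_mul]
    have h1 : ∀ i ∈ Finset.range J, ‖∑ j ∈ Finset.range J,
        (if (E : ℤ) ∣ -(a * E' + ((i : ℤ) - j)) then (E : ℂ) else 0) *
          (unitExp (a * N / e) * Z ((i : ℤ) - j))‖ ≤ E * S := by
      intro i hi
      rw [Finset.mem_range] at hi
      calc _ ≤ ∑ j ∈ Finset.range J,
            (if (E : ℤ) ∣ -(a * E' + ((i : ℤ) - j)) then (E : ℝ) * S else 0) := by
            refine (norm_sum_le _ _).trans (Finset.sum_le_sum fun j hj => ?_)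
            rw [Finset.mem_range] at hj
            split_ifs with hd
            · rw [norm_mul, norm_mul, norm_unitExp, one_mul, Complex.norm_natCast]
              refine mul_le_mul_of_nonneg_left ?_ hEr.le
              obtain ⟨q, hq⟩ := hd
              have hij : (i : ℤ) - j = E' * (-(e * q) - a) := by
                have : (E : ℤ) = e * E' := by exact_mod_cast hE'
                rw [this] at hq
                linear_combination -hq
              have hh0 : (-(e * q) - a : ℤ) ≠ 0 := by
                intro h0
                have hda : (e : ℤ) ∣ a := ⟨-q, by linarith⟩
                have := Nat.le_of_dvd (Nat.pos_of_ne_zero ha.1) (by exact_mod_cast hda)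
                omega
              have hhe : |(-(e * q) - a : ℤ)| < e := by
                have h2 : |(i : ℤ) - j| < E := by rw [abs_lt]; constructor <;> omega
                rw [hij, abs_mul, Nat.abs_cast, hE', Nat.cast_mul,
                  mul_comm (e : ℤ) (E' : ℤ)] at h2
                exact lt_of_mul_lt_mul_left h2 (by positivity)
              have h3 := hS _ hh0 hhe
              refine le_trans (le_of_eq ?_) h3
              congr 1
              refine Finset.sum_congr rfl fun k _ => ?_
              congr 1
              rw [hij, hEe]
              push_cast
              field_simp
            · simp
        _ = ((Finset.range J).filter fun j : ℕ =>
              (E : ℤ) ∣ -(a * E' + ((i : ℤ) - j))).card * (E * S) := by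
            rw [← Finset.sum_filter, Finset.sum_const, nsmul_eq_mul]
        _ ≤ 1 * (E * S) := by
            refine mul_le_mul_of_nonneg_right ?_ (by positivity)
            have : ((Finset.range J).filter fun j : ℕ =>
              (E : ℤ) ∣ -(a * E' + ((i : ℤ) - j))).card ≤ 1 := by
              rw [Finset.card_le_one]
              intro j hj j' hj'
              simp only [Finset.mem_filter, Finset.mem_range] at hj hj'
              have hd := dvd_sub hj.2 hj'.2
              have h0 : -(a * E' + ((i : ℤ) - j)) - -(a * E' + ((i : ℤ) - j')) = j - j' := by ring
              rw [h0] at hd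
              have := Int.eq_zero_of_abs_lt_dvd hd (by rw [abs_lt]; constructor <;> omega)
              omega
            exact_mod_cast this
        _ = E * S := one_mul _
    calc _ ≤ ‖(1 / (e * (J : ℂ) ^ 2))‖ * (∑ i ∈ Finset.range J, E * S) := by
          refine mul_le_mul_of_nonneg_left ?_ (norm_nonneg _)
          exact (norm_sum_le _ _).trans (Finset.sum_le_sum h1)
      _ = 8 * S / e := by
          rw [norm_div, norm_mul, norm_pow, Complex.norm_natCast, Complex.norm_natCast, norm_one,
            Finset.sum_const, Finset.card_range, nsmul_eq_mul, hE8]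
          field_simp
  have hsplit : ∑ a ∈ Finset.range e, U a = U 0 + ∑ a ∈ (Finset.range e).erase 0, U a :=
    (Finset.add_sum_erase _ _ (Finset.mem_range.2 he)).symm
  rw [← Real.norm_eq_abs, ← Complex.norm_real, Complex.ofReal_sub, hT, hsplit, hU0]
  push_cast
  rw [add_sub_cancel_left]
  calc _ ≤ ∑ a ∈ (Finset.range e).erase 0, 8 * S / e :=
        (norm_sum_le _ _).trans (Finset.sum_le_sum hUa)
    _ ≤ ∑ a ∈ Finset.range e, 8 * S / e :=
        Finset.sum_le_sum_of_subset_of_nonneg (Finset.erase_subset _ _)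
          fun _ _ _ => by positivity
    _ = 8 * S := by
        rw [Finset.sum_const, Finset.card_range, nsmul_eq_mul]
        field_simp

/-! ### The two-dimensional Selberg sieve. -/

lemma sum_Ioc_filter_dvd {α : Type*} [AddCommMonoid α] {A B D : ℕ} (hD : 1 ≤ D) (f : ℕ → α) :
    ∑ n ∈ Finset.Ioc A B with D ∣ n, f n =
      ∑ j ∈ Finset.range (B / D - A / D), f (D * (A / D + 1 + j)) := by
  symm
  refine Finset.sum_nbij' (fun j => D * (A / D + 1 + j)) (fun n => n / D - (A / D + 1))
    ?_ ?_ ?_ ?_ (fun _ _ => rfl)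
  · intro j hj
    rw [Finset.mem_range] at hj
    rw [Finset.mem_filter, Finset.mem_Ioc]
    refine ⟨⟨?_, ?_⟩, dvd_mul_right _ _⟩
    · calc A < D * (A / D + 1) := by
            rw [mul_comm]; exact Nat.lt_mul_of_div_lt (Nat.lt_succ_self _) hD
        _ ≤ _ := Nat.mul_le_mul_left _ (by omega)
    · calc D * (A / D + 1 + j) ≤ D * (B / D) := Nat.mul_le_mul_left _ (by omega)
        _ ≤ B := Nat.mul_div_le B D
  · intro n hn
    rw [Finset.mem_filter, Finset.mem_Ioc] at hn
    obtain ⟨⟨h1, h2⟩, k, rfl⟩ := hn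
    rw [Finset.mem_range, Nat.mul_div_cancel_left k hD]
    have h3 : A / D < k := Nat.div_lt_of_lt_mul h1
    have h4 : k ≤ B / D := (Nat.le_div_iff_mul_le hD).2 (by rwa [mul_comm])
    omega
  · intro j _
    simp only [Nat.mul_div_cancel_left _ hD]
    omega
  · intro n hn
    rw [Finset.mem_filter, Finset.mem_Ioc] at hn
    obtain ⟨⟨h1, h2⟩, k, rfl⟩ := hn
    simp only [Nat.mul_div_cancel_left k hD]
    have h3 : A / D < k := Nat.div_lt_of_lt_mul h1
    congr 1
    omega

lemma abs_card_Ioc_filter_dvd_sub_le {A B D : ℕ} (hD : 1 ≤ D) (hAB : A ≤ B) :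
    |(((Finset.Ioc A B).filter (D ∣ ·)).card : ℝ) - ((B : ℝ) - A) / D| ≤ 1 := by
  have hcard : ((Finset.Ioc A B).filter (D ∣ ·)).card = B / D - A / D := by
    rw [Finset.card_eq_sum_ones, sum_Ioc_filter_dvd hD]; simp
  have hD0 : (0 : ℝ) < D := by exact_mod_cast hD
  rw [hcard, Nat.cast_sub (Nat.div_le_div_right hAB)]
  have bound : ∀ n : ℕ, ((n / D : ℕ) : ℝ) ≤ n / D ∧ (n : ℝ) / D < ((n / D : ℕ) : ℝ) + 1 := by
    intro n
    refine ⟨Nat.cast_div_le, ?_⟩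
    rw [div_lt_iff₀ hD0]
    have := Nat.lt_mul_of_div_lt (Nat.lt_succ_self (n / D)) hD
    exact_mod_cast this
  have h1 := bound A
  have h2 := bound B
  rw [sub_div, abs_le]
  constructor <;> linarith [h1.1, h1.2, h2.1, h2.2]

lemma sq_sum_dvd_eq (s : Finset ℕ) (w : ℕ → ℝ) (P : ℕ → Prop)
    [DecidablePred P] (hP : ∀ a b, P (Nat.lcm a b) ↔ P a ∧ P b) :
    (∑ d ∈ s, if P d then w d else 0) ^ 2 =
      ∑ p ∈ s ×ˢ s, w p.1 * w p.2 * if P (Nat.lcm p.1 p.2) then 1 else 0 := by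
  rw [sq, Finset.sum_mul_sum, ← Finset.sum_product']
  refine Finset.sum_congr rfl fun p _ => ?_
  simp only [hP]
  by_cases h1 : P p.1 <;> by_cases h2 : P p.2 <;> simp [h1, h2]

/-- The two-dimensional Selberg sieve, for pairs `(n, N - ⌊y n⌋)` that are jointly equidistributed
in residue classes, in terms of exponential sums. -/
theorem card_sifted_le {A B R N : ℕ} {S : ℝ} (y : ℕ → ℝ) (hy : ∀ n, 0 ≤ y n) (hAB : A ≤ B)
    (hR : 1 ≤ R) (hS1 : 1 ≤ S)
    (hS : ∀ D e : ℕ, 1 ≤ D → D ≤ R ^ 2 → 1 ≤ e → e ≤ R ^ 2 → ∀ h : ℤ, h ≠ 0 → |h| < e →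
      ‖∑ n ∈ Finset.Ioc A B with D ∣ n, unitExp (h * y n / e)‖ ≤ S) :
    (((Finset.Ioc A B).filter fun n => (∀ d, 2 ≤ d → d ≤ R → ¬ d ∣ n) ∧
      ∀ d : ℕ, 2 ≤ d → d ≤ R → ¬ (d : ℤ) ∣ (N : ℤ) - ⌊y n⌋₊).card : ℝ) ≤
      16 * ((B : ℝ) - A) / Real.log (R + 1) ^ 2 + 32 * S * (R : ℝ) ^ 8 := by
  classical
  -- Any `J` divisible by all `d ≤ R` would do; its enormous size is harmless because the Fejér
  -- estimate is uniform in `E`.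
  set J : ℕ := R.factorial with hJdef
  have hJ : 1 ≤ J := Nat.factorial_pos R
  set E : ℕ := 8 * J with hE
  have hE0 : E ≠ 0 := by omega
  set I := Finset.Icc 1 R with hI
  set w := selbergWeight R with hw
  set P := I ×ˢ I with hP
  have hlcm1 : ∀ p ∈ P, 1 ≤ Nat.lcm p.1 p.2 := by
    intro p hp
    rw [hP, Finset.mem_product, hI, Finset.mem_Icc, Finset.mem_Icc] at hp
    exact Nat.lcm_pos hp.1.1 hp.2.1
  have hlcmR : ∀ p ∈ P, Nat.lcm p.1 p.2 ≤ R ^ 2 := by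
    intro p hp
    rw [hP, Finset.mem_product, hI, Finset.mem_Icc, Finset.mem_Icc] at hp
    rw [sq]
    exact (Nat.le_of_dvd (Nat.mul_pos hp.1.1 hp.2.1) (Nat.lcm_dvd_mul _ _)).trans
      (Nat.mul_le_mul hp.1.2 hp.2.2)
  have hdvdE : ∀ d ∈ I, d ∣ E := by
    intro d hd
    rw [hI, Finset.mem_Icc] at hd
    exact (Nat.dvd_factorial hd.1 hd.2).mul_left 8
  have hlcmE : ∀ p ∈ P, Nat.lcm p.1 p.2 ∣ E := by
    intro p hp
    rw [hP, Finset.mem_product] at hp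
    exact Nat.lcm_dvd (hdvdE _ hp.1) (hdvdE _ hp.2)
  have h1I : 1 ∈ I := by rw [hI, Finset.mem_Icc]; exact ⟨le_rfl, hR⟩
  set ν : ℕ → ℝ := fun n => (∑ d ∈ I, if d ∣ n then w d else 0) ^ 2 with hν
  set V : ℕ → ℝ := fun m => (∑ d ∈ I, if (d : ℤ) ∣ (N : ℤ) - m then w d else 0) ^ 2 with hV
  set k : ℕ → ℕ → ℝ := fun n m => fejer E J (y n - m) with hk
  have hk0 : ∀ n m, 0 ≤ k n m := fun n m => fejer_nonneg _ _ _
  -- each sifted element contributes at least `1 / 2`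
  have hcontrib : (((Finset.Ioc A B).filter fun n => (∀ d, 2 ≤ d → d ≤ R → ¬ d ∣ n) ∧
      ∀ d : ℕ, 2 ≤ d → d ≤ R → ¬ (d : ℤ) ∣ (N : ℤ) - ⌊y n⌋₊).card : ℝ) ≤
      2 * ∑ n ∈ Finset.Ioc A B, ∑ m ∈ Finset.range E, ν n * V m * k n m := by
    rw [Finset.card_filter]
    push_cast
    rw [Finset.mul_sum]
    refine Finset.sum_le_sum fun n _ => ?_
    have hnn : 0 ≤ ∑ m ∈ Finset.range E, ν n * V m * k n m :=
      Finset.sum_nonneg fun m _ => mul_nonneg (mul_nonneg (sq_nonneg _) (sq_nonneg _)) (hk0 n m)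
    split_ifs with hn
    · have hνn : ν n = 1 := by
        have : ∑ d ∈ I, (if d ∣ n then w d else 0) = 1 := by
          rw [Finset.sum_eq_single 1]
          · simp [hw, selbergWeight_one hR]
          · intro d hd hd1
            rw [hI, Finset.mem_Icc] at hd
            exact if_neg (hn.1 d (by omega) hd.2)
          · intro h; exact absurd h1I h
        simp only [hν, this, one_pow]
      have hVn : V (⌊y n⌋₊ % E) = 1 := by
        have : ∑ d ∈ I, (if (d : ℤ) ∣ (N : ℤ) - (⌊y n⌋₊ % E : ℕ) then w d else 0) = 1 := by
          rw [Finset.sum_eq_single 1]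
          · simp [hw, selbergWeight_one hR]
          · intro d hd hd1
            have hdE := hdvdE d hd
            rw [hI, Finset.mem_Icc] at hd
            rw [if_neg]
            intro hdv
            refine hn.2 d (by omega) hd.2 ?_
            have e1 : (N : ℤ) - ⌊y n⌋₊ = (N : ℤ) - (⌊y n⌋₊ % E : ℕ) - E * (⌊y n⌋₊ / E : ℕ) := by
              have := Nat.mod_add_div ⌊y n⌋₊ E
              have h2 : ((⌊y n⌋₊ % E : ℕ) : ℤ) + E * (⌊y n⌋₊ / E : ℕ) = ⌊y n⌋₊ := by
                exact_mod_cast this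
              linarith
            rw [e1]
            exact dvd_sub hdv ((Int.natCast_dvd_natCast.2 hdE).mul_right _)
          · intro h; exact absurd h1I h
        simp only [hV, this, one_pow]
      have hkn : 1 / 2 ≤ k n (⌊y n⌋₊ % E) := by
        have e1 : y n - (⌊y n⌋₊ % E : ℕ) = (y n - ⌊y n⌋₊) + E * ((⌊y n⌋₊ / E : ℕ) : ℤ) := by
          have := Nat.mod_add_div ⌊y n⌋₊ E
          have h2 : ((⌊y n⌋₊ % E : ℕ) : ℝ) + E * (⌊y n⌋₊ / E : ℕ) = ⌊y n⌋₊ := by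
            exact_mod_cast this
          rw [Int.cast_natCast]
          linarith
        simp only [hk]
        rw [e1, fejer_add_mul hE0]
        exact half_le_fejer hJ hE (by linarith [Nat.floor_le (hy n)])
          (by linarith [Nat.lt_floor_add_one (y n)])
      have hsingle := Finset.single_le_sum (f := fun m => ν n * V m * k n m)
        (fun m _ => mul_nonneg (mul_nonneg (sq_nonneg _) (sq_nonneg _)) (hk0 n m))
        (Finset.mem_range.2 (Nat.mod_lt ⌊y n⌋₊ (Nat.pos_of_ne_zero hE0)))
      simp only [hνn, hVn, one_mul] at hsingle
      rw [hνn]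
      simp only [one_mul]
      linarith
    · linarith
  set T : ℕ → ℕ → ℝ := fun D e => ∑ n ∈ Finset.Ioc A B with D ∣ n, ∑ m ∈ Finset.range E,
    if (e : ℤ) ∣ (N : ℤ) - m then k n m else 0 with hT
  have hexpand : ∑ n ∈ Finset.Ioc A B, ∑ m ∈ Finset.range E, ν n * V m * k n m =
      ∑ p ∈ P, ∑ q ∈ P, (w p.1 * w p.2) * (w q.1 * w q.2) *
        T (Nat.lcm p.1 p.2) (Nat.lcm q.1 q.2) := by
    have h1 : ∀ n m, ν n * V m * k n m = ∑ p ∈ P, ∑ q ∈ P, (w p.1 * w p.2) * (w q.1 * w q.2) *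
        ((if Nat.lcm p.1 p.2 ∣ n then 1 else 0) *
          if ((Nat.lcm q.1 q.2 : ℕ) : ℤ) ∣ (N : ℤ) - m then k n m else 0) := by
      intro n m
      simp only [hν, hV]
      rw [sq_sum_dvd_eq I w (fun d => d ∣ n) fun a b => Nat.lcm_dvd_iff,
        sq_sum_dvd_eq I w (fun d => (d : ℤ) ∣ (N : ℤ) - m) fun a b => by
          simp only [Int.natCast_dvd]; exact Nat.lcm_dvd_iff,
        Finset.sum_mul_sum, Finset.sum_mul]
      refine Finset.sum_congr rfl fun p _ => ?_
      rw [Finset.sum_mul]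
      refine Finset.sum_congr rfl fun q _ => ?_
      split_ifs <;> ring
    simp only [h1]
    rw [Finset.sum_congr rfl fun n _ => Finset.sum_comm, Finset.sum_comm]
    refine Finset.sum_congr rfl fun p _ => ?_
    rw [Finset.sum_congr rfl fun n _ => Finset.sum_comm, Finset.sum_comm]
    refine Finset.sum_congr rfl fun q _ => ?_
    simp only [hT]
    rw [Finset.sum_filter, Finset.mul_sum]
    refine Finset.sum_congr rfl fun n _ => ?_
    rw [← Finset.mul_sum, ← Finset.mul_sum]
    congr 1
    split_ifs <;> simp
  -- `8 * S` comes from the exponential sums and at most `8 ≤ 8 * S` from rounding in the count of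
  -- multiples of `D`.
  have hTbound : ∀ p ∈ P, ∀ q ∈ P, |T (Nat.lcm p.1 p.2) (Nat.lcm q.1 q.2) -
      8 * ((B : ℝ) - A) / ((Nat.lcm p.1 p.2 : ℝ) * (Nat.lcm q.1 q.2 : ℝ))| ≤ 16 * S := by
    intro p hp q hq
    set D := Nat.lcm p.1 p.2 with hD
    set e := Nat.lcm q.1 q.2 with he
    have hD1 : 1 ≤ D := hlcm1 p hp
    have he1 : 1 ≤ e := hlcm1 q hq
    have her : (1 : ℝ) ≤ e := by exact_mod_cast he1
    have hDr : (1 : ℝ) ≤ D := by exact_mod_cast hD1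
    have h1 := abs_sum_fejer_sub_le hJ hE he1 (hlcmE q hq) N ((Finset.Ioc A B).filter (D ∣ ·)) y
      (by linarith) (hS D e hD1 (hlcmR p hp) he1 (hlcmR q hq))
    have h2 := abs_card_Ioc_filter_dvd_sub_le hD1 hAB
    set cnt : ℝ := (((Finset.Ioc A B).filter (D ∣ ·)).card : ℝ) with hcnt
    have h3 : |8 * cnt / e - 8 * ((B : ℝ) - A) / ((D : ℝ) * e)| ≤ 8 := by
      have e1 : 8 * cnt / e - 8 * ((B : ℝ) - A) / ((D : ℝ) * e) =
          8 / e * (cnt - ((B : ℝ) - A) / D) := by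
        field_simp
      rw [e1, abs_mul, abs_of_pos (by positivity)]
      calc 8 / (e : ℝ) * |cnt - ((B : ℝ) - A) / D| ≤ 8 * 1 := by
            gcongr
            exact div_le_self (by norm_num) her
        _ = 8 := by norm_num
    have h4 := abs_sub_le (T D e) (8 * cnt / e) (8 * ((B : ℝ) - A) / ((D : ℝ) * e))
    have h5 : |T D e - 8 * cnt / e| ≤ 8 * S := h1
    linarith
  have hw0 : ∀ p ∈ P, |w p.1 * w p.2| ≤ (R : ℝ) ^ 2 := by
    intro p hp
    rw [hP, Finset.mem_product, hI, Finset.mem_Icc, Finset.mem_Icc] at hp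
    rw [abs_mul, sq]
    have h1 : |w p.1| ≤ R := (abs_selbergWeight_le hR _).trans (by exact_mod_cast hp.1.2)
    have h2 : |w p.2| ≤ R := (abs_selbergWeight_le hR _).trans (by exact_mod_cast hp.2.2)
    gcongr
  -- The density `1 / (D * e)` factors without any coprimality, so the main term is the square of
  -- the one-dimensional minimum.
  have hmain : ∑ p ∈ P, ∑ q ∈ P, (w p.1 * w p.2) * (w q.1 * w q.2) *
      (8 * ((B : ℝ) - A) / ((Nat.lcm p.1 p.2 : ℝ) * (Nat.lcm q.1 q.2 : ℝ))) =
      8 * ((B : ℝ) - A) * (1 / selbergG R) ^ 2 := by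
    have h1 : ∑ p ∈ P, w p.1 * w p.2 / (Nat.lcm p.1 p.2 : ℝ) = 1 / selbergG R := by
      rw [hP, Finset.sum_product, ← sum_selbergWeight_lcm hR]
    rw [← h1, sq, Finset.sum_mul_sum, Finset.mul_sum]
    refine Finset.sum_congr rfl fun p hp => ?_
    rw [Finset.mul_sum]
    refine Finset.sum_congr rfl fun q hq => ?_
    have a1 : (Nat.lcm p.1 p.2 : ℝ) ≠ 0 := by
      exact_mod_cast (Nat.pos_iff_ne_zero.1 (hlcm1 p hp))
    have a2 : (Nat.lcm q.1 q.2 : ℝ) ≠ 0 := by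
      exact_mod_cast (Nat.pos_iff_ne_zero.1 (hlcm1 q hq))
    field_simp
  have herr : ∑ p ∈ P, ∑ q ∈ P, (w p.1 * w p.2) * (w q.1 * w q.2) *
        T (Nat.lcm p.1 p.2) (Nat.lcm q.1 q.2) ≤
      8 * ((B : ℝ) - A) * (1 / selbergG R) ^ 2 + 16 * S * (R : ℝ) ^ 8 := by
    rw [← hmain, ← sub_le_iff_le_add', ← Finset.sum_sub_distrib]
    have hPc : ((P.card : ℕ) : ℝ) = (R : ℝ) ^ 2 := by
      rw [hP, Finset.card_product, hI, Nat.card_Icc]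
      push_cast [Nat.add_sub_cancel]
      ring
    calc _ ≤ ∑ p ∈ P, ∑ q ∈ P, (R : ℝ) ^ 2 * (R : ℝ) ^ 2 * (16 * S) := by
          refine Finset.sum_le_sum fun p hp => ?_
          rw [← Finset.sum_sub_distrib]
          refine Finset.sum_le_sum fun q hq => ?_
          rw [← mul_sub]
          refine (le_abs_self _).trans ?_
          rw [abs_mul, abs_mul]
          have a1 := hw0 p hp
          have a2 := hw0 q hq
          have a3 := hTbound p hp q hq
          gcongr
      _ = 16 * S * (R : ℝ) ^ 8 := by
          simp only [Finset.sum_const, nsmul_eq_mul, hPc]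
          ring
  have hlog := log_le_selbergG R
  have hlog0 : 0 < Real.log (R + 1) := Real.log_pos (by
    have : (1 : ℝ) ≤ R := by exact_mod_cast hR
    linarith)
  have hBA : 0 ≤ (B : ℝ) - A := sub_nonneg.2 (by exact_mod_cast hAB)
  calc _ ≤ 2 * (8 * ((B : ℝ) - A) * (1 / selbergG R) ^ 2 + 16 * S * (R : ℝ) ^ 8) := by
        refine hcontrib.trans ?_
        rw [hexpand]
        linarith
    _ ≤ 2 * (8 * ((B : ℝ) - A) * (1 / Real.log (R + 1)) ^ 2 + 16 * S * (R : ℝ) ^ 8) := by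
        gcongr
        exact (one_div_pos.2 (selbergG_pos hR)).le
    _ = _ := by field_simp; ring

/-! ### From the sieve to `Upsilon`. -/

/-- Since `q` is determined by `p`, it suffices to count the primes `p`. -/
lemma Upsilon_le_card {c : ℝ} {N : ℕ} (t : Finset ℕ)
    (h : ∀ p q : ℕ, p.Prime → q.Prime → N = ⌊(p : ℝ) ^ c⌋₊ + q → p ∈ t) :
    Upsilon c N ≤ t.card := by
  rw [Upsilon, ← Set.ncard_coe_finset t]
  refine Set.ncard_le_ncard_of_injOn Prod.fst ?_ ?_ t.finite_toSet
  · rintro ⟨p, q⟩ ⟨hp, hq, hN⟩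
    exact h p q hp hq hN
  · rintro ⟨p, q⟩ ⟨_, _, h1⟩ ⟨p', q'⟩ ⟨_, _, h2⟩ hpp
    simp only at h1 h2 hpp
    subst hpp
    simp only [Prod.mk.injEq, true_and]
    omega

lemma le_rpow_of_floor_rpow_le {c : ℝ} (hc : 0 < c) {p N : ℕ} (h : ⌊(p : ℝ) ^ c⌋₊ ≤ N) :
    (p : ℝ) ≤ ((N : ℝ) + 1) ^ (1 / c) := by
  have h1 : (p : ℝ) ^ c ≤ (N : ℝ) + 1 := by
    have h2 := Nat.lt_floor_add_one ((p : ℝ) ^ c)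
    have h3 : ((⌊(p : ℝ) ^ c⌋₊ : ℕ) : ℝ) ≤ N := by exact_mod_cast h
    linarith
  calc (p : ℝ) = ((p : ℝ) ^ c) ^ (1 / c) := by
        rw [one_div, Real.rpow_rpow_inv (by positivity) hc.ne']
    _ ≤ _ := Real.rpow_le_rpow (by positivity) h1 (by positivity)

lemma Upsilon_le_rpow {c : ℝ} (hc : 0 < c) (N : ℕ) :
    (Upsilon c N : ℝ) ≤ ((N : ℝ) + 1) ^ (1 / c) := by
  have h := Upsilon_le_card (c := c) (N := N) (Finset.Icc 1 ⌊((N : ℝ) + 1) ^ (1 / c)⌋₊)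
    fun p q hp _ hN => by
      rw [Finset.mem_Icc]
      exact ⟨hp.one_lt.le, Nat.le_floor (le_rpow_of_floor_rpow_le hc (by omega))⟩
  rw [Nat.card_Icc, Nat.add_sub_cancel] at h
  exact le_trans (by exact_mod_cast h) (Nat.floor_le (by positivity))

lemma norm_sum_unitExp_neg {ι : Type*} (s : Finset ι) (f : ι → ℝ) :
    ‖∑ k ∈ s, unitExp (-f k)‖ = ‖∑ k ∈ s, unitExp (f k)‖ := by
  rw [← RCLike.norm_conj (∑ k ∈ s, unitExp (f k)), map_sum]
  simp only [unitExp_neg]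

/-- The exponential sums that control the equidistribution of `⌊n ^ c⌋` modulo `e`, for `n` in a
residue class modulo `D`. -/
lemma norm_sum_filter_dvd_unitExp_le {c δ X Q : ℝ} {s D e H : ℕ} (hδ : 0 < δ) (hδ1 : δ ≤ 1)
    (h1 : s + δ ≤ c) (h2 : c ≤ s + 1 - δ) (hD : 1 ≤ D) (hDQ : (D : ℝ) ≤ Q) (hH : 1 ≤ H)
    (hHQ : (H : ℝ) ≤ Q) (heQ : (e : ℝ) ≤ Q) (hX1 : 1 ≤ X)
    (hbig : 4 * (Q ^ (2 * s + 7) * ((s : ℝ) + 1) ^ (s + 1) * (1 / δ) ^ (2 * (s + 1))) ≤ X ^ δ)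
    (hAB : ⌊X / Q⌋₊ ≤ ⌊X⌋₊) {h : ℤ} (hh : h ≠ 0) (hhe : |h| < e) :
    ‖∑ n ∈ Finset.Ioc ⌊X / Q⌋₊ ⌊X⌋₊ with D ∣ n, unitExp (h * (n : ℝ) ^ c / e)‖ ≤
      6 * X * ((H : ℝ)⁻¹) ^ ((1 / 2 : ℝ) ^ s) := by
  set A := ⌊X / Q⌋₊ with hA
  set B := ⌊X⌋₊ with hB
  have hQ0 : 0 < Q := lt_of_lt_of_le (by exact_mod_cast hD) hDQ
  have he0 : (0 : ℝ) < e := by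
    have : (0 : ℤ) < e := (abs_nonneg h).trans_lt hhe
    exact_mod_cast this
  have habs : ‖∑ n ∈ Finset.Ioc A B with D ∣ n, unitExp (h * (n : ℝ) ^ c / e)‖ =
      ‖∑ n ∈ Finset.Ioc A B with D ∣ n, unitExp (((|h| : ℤ) : ℝ) / e * (n : ℝ) ^ c)‖ := by
    rcases abs_choice h with h3 | h3
    · rw [h3]
      congr 1
      refine Finset.sum_congr rfl fun n _ => ?_
      congr 1
      ring
    · rw [h3, ← norm_sum_unitExp_neg]
      congr 1
      refine Finset.sum_congr rfl fun n _ => ?_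
      congr 1
      push_cast
      ring
  rw [habs, sum_Ioc_filter_dvd hD]
  have hsum : ∀ j : ℕ, ((D * (A / D + 1 + j) : ℕ) : ℝ) = ((D * (A / D + 1) : ℕ) : ℝ) + D * j := by
    intro j; push_cast; ring
  simp only [hsum]
  have hh1 : (1 : ℝ) ≤ ((|h| : ℤ) : ℝ) := by exact_mod_cast Int.one_le_abs hh
  refine norm_sum_unitExp_rpow_le hδ hδ1 h1 h2 hD hDQ hH hHQ ?_ ?_ hX1 ?_ ?_ hbig ?_
  · gcongr
  · rw [div_le_one he0]
    have : ((|h| : ℤ) : ℝ) < ((e : ℤ) : ℝ) := by exact_mod_cast hhe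
    rw [Int.cast_natCast] at this
    exact this.le
  · have h4 : A < D * (A / D + 1) := by
      rw [mul_comm]; exact Nat.lt_mul_of_div_lt (Nat.lt_succ_self _) hD
    have h5 : ((A + 1 : ℕ) : ℝ) ≤ ((D * (A / D + 1) : ℕ) : ℝ) := by exact_mod_cast h4
    have h6 := Nat.lt_floor_add_one (X / Q)
    push_cast at h5 ⊢
    linarith
  · exact_mod_cast Nat.le_mul_of_pos_right D (Nat.succ_pos _)
  · have h4 : A / D ≤ B / D := Nat.div_le_div_right hAB
    have h5 : D * (A / D + 1) + D * (B / D - A / D) = D * (B / D) + D := by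
      rw [← mul_add, ← Nat.mul_succ]
      congr 1
      omega
    have h6 : D * (B / D) ≤ B := Nat.mul_div_le B D
    have h7 : ((D * (A / D + 1) + D * (B / D - A / D) : ℕ) : ℝ) ≤ ((B + D : ℕ) : ℝ) := by
      exact_mod_cast h5.trans_le (Nat.add_le_add_right h6 D)
    have h8 : (B : ℝ) ≤ X := Nat.floor_le (by linarith)
    push_cast at h7 ⊢
    rw [Nat.cast_sub h4] at *
    linarith

/-- Bernoulli bound for the increments of a power. -/
lemma rpow_sub_rpow_le {a b s : ℝ} (hs : 0 < s) (ha : 0 ≤ a) (hb : 0 < b) (hab : a ≤ b) :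
    b ^ s - a ^ s ≤ b ^ s * ((1 + s) * ((b - a) / b)) := by
  have hx0 : 0 ≤ (b - a) / b := div_nonneg (by linarith) hb.le
  have hx1 : (b - a) / b ≤ 1 := (div_le_one hb).2 (by linarith)
  have hab' : a = b * (1 + -((b - a) / b)) := by field_simp; ring
  -- Bernoulli's inequality covers `s ≥ 1`; for `s ≤ 1` a base in `[0, 1]` does not exceed its own
  -- power. The factor `1 + s` serves both cases.
  have key : 1 - (1 + s) * ((b - a) / b) ≤ (1 + -((b - a) / b)) ^ s := by
    rcases le_total 1 s with h | h
    · have := one_add_mul_self_le_rpow_one_add (s := -((b - a) / b)) (by linarith) h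
      nlinarith
    · calc 1 - (1 + s) * ((b - a) / b) ≤ 1 + -((b - a) / b) := by nlinarith
        _ = (1 + -((b - a) / b)) ^ (1 : ℝ) := (Real.rpow_one _).symm
        _ ≤ _ := Real.rpow_le_rpow_of_exponent_ge_of_imp (by linarith) (by linarith) h
          fun _ h' => absurd h' one_ne_zero
  have e : a ^ s = b ^ s * (1 + -((b - a) / b)) ^ s := by
    conv_lhs => rw [hab']
    rw [Real.mul_rpow hb.le (by linarith)]
  rw [e]
  have hbs : 0 < b ^ s := by positivity
  nlinarith

set_option maxHeartbeats 1000000 in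
/-- The sieve bound once `N` is large in terms of the sieve parameters. -/
theorem Upsilon_le_of_large {c δ X Q T : ℝ} {s N : ℕ} (hδ : 0 < δ) (hδ1 : δ ≤ 1)
    (h1 : s + δ ≤ c) (h2 : c ≤ s + 1 - δ) (hX : X = ((N : ℝ) + 1) ^ (1 / c))
    (hT1 : 1 < T) (hTN : T ^ 2 ≤ N) (hTQ : T ^ 16 ≤ Q) (hQ2 : 2 ≤ Q)
    (hTQs : T ^ 16 ≤ Q ^ ((1 / 2 : ℝ) ^ s))
    (hbig : 4 * (Q ^ (2 * s + 7) * ((s : ℝ) + 1) ^ (s + 1) * (1 / δ) ^ (2 * (s + 1))) ≤ X ^ δ) :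
    (Upsilon c N : ℝ) ≤ X * ((388 + 2 / δ) / T + 16 / Real.log T ^ 2) := by
  have hs0 : (0 : ℝ) ≤ s := Nat.cast_nonneg s
  have hc : 0 < c := by linarith
  have hcδ : 1 / c ≤ 1 / δ := one_div_le_one_div_of_le hδ (by linarith)
  have hT0 : 0 < T := by linarith
  have hQ0 : 0 < Q := by linarith
  have hN0 : (0 : ℝ) ≤ N := Nat.cast_nonneg N
  have hX1 : 1 ≤ X := by rw [hX]; exact Real.one_le_rpow (by linarith) (by positivity)
  have hX0 : 0 < X := by linarith
  have hTpow : ∀ k, 1 ≤ k → T ≤ T ^ k := fun k hk => le_self_pow₀ hT1.le (by omega)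
  have hTQ1 : T ≤ Q := (hTpow 16 (by norm_num)).trans hTQ
  have hQX : Q ^ 2 ≤ X := by
    have e1 : (1 : ℝ) ≤ ((s : ℝ) + 1) ^ (s + 1) := one_le_pow₀ (by linarith)
    have e2 : (1 : ℝ) ≤ (1 / δ) ^ (2 * (s + 1)) :=
      one_le_pow₀ (by rw [le_div_iff₀ hδ]; linarith)
    have e3 : X ^ δ ≤ X := by
      calc X ^ δ ≤ X ^ (1 : ℝ) := Real.rpow_le_rpow_of_exponent_le hX1 hδ1
        _ = X := Real.rpow_one X
    calc Q ^ 2 = 1 * (Q ^ 2 * 1 * 1) := by ring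
      _ ≤ 4 * (Q ^ (2 * s + 7) * ((s : ℝ) + 1) ^ (s + 1) * (1 / δ) ^ (2 * (s + 1))) := by
        gcongr
        · norm_num
        · linarith
        · omega
      _ ≤ X := hbig.trans e3
  have hQXd : Q ≤ X / Q := by rw [le_div_iff₀ hQ0, ← sq]; exact hQX
  set R := ⌊T⌋₊ with hR
  set A := ⌊X / Q⌋₊ with hA
  set B := ⌊X⌋₊ with hB
  set H := ⌊Q⌋₊ with hH
  have hR1 : 1 ≤ R := Nat.le_floor (by simpa using hT1.le)
  have hRT : (R : ℝ) ≤ T := Nat.floor_le hT0.le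
  have hTR : T < R + 1 := Nat.lt_floor_add_one T
  have hH1 : 1 ≤ H := Nat.le_floor (by push_cast; linarith)
  have hHQ : (H : ℝ) ≤ Q := Nat.floor_le hQ0.le
  have hRA : R ≤ A := Nat.floor_le_floor (hTQ1.trans hQXd)
  have hAB : A ≤ B := Nat.floor_le_floor (div_le_self hX0.le (by linarith))
  have hBX : (B : ℝ) ≤ X := Nat.floor_le hX0.le
  have hAX : (A : ℝ) ≤ X / Q := Nat.floor_le (by positivity)
  have hR2Q : ((R ^ 2 : ℕ) : ℝ) ≤ Q := by
    push_cast
    calc (R : ℝ) ^ 2 ≤ T ^ 2 := by gcongr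
      _ ≤ T ^ 16 := pow_le_pow_right₀ hT1.le (by norm_num)
      _ ≤ Q := hTQ
  set κ : ℝ := (1 / 2 : ℝ) ^ s with hκ
  have hκ0 : 0 < κ := by positivity
  have hκ1 : κ ≤ 1 := pow_le_one₀ (by norm_num) (by norm_num)
  have hHκ : ((H : ℝ)⁻¹) ^ κ ≤ 2 / T ^ 16 := by
    have e1 : (H : ℝ)⁻¹ ≤ 2 / Q := by
      have : Q < H + 1 := Nat.lt_floor_add_one Q
      rw [inv_le_comm₀ (by exact_mod_cast hH1) (by positivity), inv_div]
      linarith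
    calc ((H : ℝ)⁻¹) ^ κ ≤ (2 / Q) ^ κ := Real.rpow_le_rpow (by positivity) e1 hκ0.le
      _ = 2 ^ κ / Q ^ κ := Real.div_rpow (by norm_num) hQ0.le κ
      _ ≤ 2 ^ (1 : ℝ) / T ^ 16 := by
        gcongr
        norm_num
      _ = 2 / T ^ 16 := by rw [Real.rpow_one]
  -- The saving `T ^ 16` leaves `X / T ^ 8` after multiplication by the `R ^ 8` of the sieve error.
  set S : ℝ := 12 * X / T ^ 16 with hS
  have hS1 : 1 ≤ S := by
    rw [hS, le_div_iff₀ (by positivity)]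
    nlinarith
  have hexp : ∀ D e : ℕ, 1 ≤ D → D ≤ R ^ 2 → 1 ≤ e → e ≤ R ^ 2 → ∀ h : ℤ, h ≠ 0 → |h| < e →
      ‖∑ n ∈ Finset.Ioc A B with D ∣ n, unitExp (h * (n : ℝ) ^ c / e)‖ ≤ S := by
    intro D e hD hDR _ heR h hh hhe
    have hDQ : (D : ℝ) ≤ Q := le_trans (by exact_mod_cast hDR) hR2Q
    have heQ : (e : ℝ) ≤ Q := le_trans (by exact_mod_cast heR) hR2Q
    refine (norm_sum_filter_dvd_unitExp_le hδ hδ1 h1 h2 hD hDQ hH1 hHQ heQ hX1 hbig hAB hh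
      hhe).trans ?_
    calc 6 * X * ((H : ℝ)⁻¹) ^ κ ≤ 6 * X * (2 / T ^ 16) := by gcongr
      _ = S := by rw [hS]; ring
  have hsieve := card_sifted_le (N := N) (fun n : ℕ => (n : ℝ) ^ c) (fun n => by positivity) hAB
    hR1 hS1 hexp
  set Z := (Finset.Ioc A B).filter fun n : ℕ => (∀ d, 2 ≤ d → d ≤ R → ¬ d ∣ n) ∧
      ∀ d : ℕ, 2 ≤ d → d ≤ R → ¬ (d : ℤ) ∣ (N : ℤ) - ⌊(n : ℝ) ^ c⌋₊ with hZ
  have hTT2 : T ≤ T ^ 2 := hTpow 2 (by norm_num)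
  have hRN : (R : ℝ) ≤ N := by linarith
  -- If `p < u` then `q > R`, so the prime `q` survives the sieve. The `p` in `[u, X]` form a short
  -- interval, bounded trivially.
  set u : ℝ := ((N : ℝ) - R) ^ (1 / c) with hu
  have hu0 : 0 ≤ u := Real.rpow_nonneg (by linarith) _
  have hcover : Upsilon c N ≤ (Finset.Ioc 0 A ∪ (Finset.Icc ⌈u⌉₊ B ∪ Z)).card := by
    refine Upsilon_le_card _ fun p q hp hq hN => ?_
    rw [Finset.mem_union, Finset.mem_union]
    have hpB : p ≤ B := by
      refine Nat.le_floor ?_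
      rw [hX]
      exact le_rpow_of_floor_rpow_le hc (by omega)
    by_cases hpA : p ≤ A
    · exact Or.inl (Finset.mem_Ioc.2 ⟨hp.pos, hpA⟩)
    · by_cases hpu : ⌈u⌉₊ ≤ p
      · exact Or.inr (Or.inl (Finset.mem_Icc.2 ⟨hpu, hpB⟩))
      · refine Or.inr (Or.inr ?_)
        rw [hZ, Finset.mem_filter, Finset.mem_Ioc]
        refine ⟨⟨by omega, hpB⟩, ?_, ?_⟩
        · intro d hd2 hdR hdp
          rcases (Nat.dvd_prime hp).1 hdp with h | h <;> omega
        · intro d hd2 hdR hdq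
          have hpu' : (p : ℝ) < u := Nat.lt_ceil.1 (not_le.1 hpu)
          have hpc : (p : ℝ) ^ c < (N : ℝ) - R := by
            calc (p : ℝ) ^ c < u ^ c := Real.rpow_lt_rpow (by positivity) hpu' hc
              _ = (N : ℝ) - R := by
                rw [hu, one_div, Real.rpow_inv_rpow (by linarith) hc.ne']
          have hfl : ((⌊(p : ℝ) ^ c⌋₊ : ℕ) : ℝ) ≤ (p : ℝ) ^ c := Nat.floor_le (by positivity)
          have hNr : (N : ℝ) = (⌊(p : ℝ) ^ c⌋₊ : ℕ) + q := by exact_mod_cast hN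
          have hqR : R < q := by
            have : (R : ℝ) < q := by linarith
            exact_mod_cast this
          have hNz : (N : ℤ) - ⌊(p : ℝ) ^ c⌋₊ = q := by omega
          rw [hNz] at hdq
          have hdq' : d ∣ q := by exact_mod_cast hdq
          rcases (Nat.dvd_prime hq).1 hdq' with h | h <;> omega
  have hcard : ((Finset.Ioc 0 A ∪ (Finset.Icc ⌈u⌉₊ B ∪ Z)).card : ℝ) ≤
      A + ((X - u + 1) + Z.card) := by
    have e1 := (Finset.card_union_le (Finset.Ioc 0 A) (Finset.Icc ⌈u⌉₊ B ∪ Z)).trans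
      (Nat.add_le_add_left (Finset.card_union_le _ _) _)
    rw [Nat.card_Ioc, Nat.card_Icc, Nat.sub_zero] at e1
    have huX : u ≤ X := by
      rw [hu, hX]
      exact Real.rpow_le_rpow (by linarith) (by linarith [(Nat.cast_nonneg R : (0 : ℝ) ≤ R)])
        (by positivity)
    have e2 : ((B + 1 - ⌈u⌉₊ : ℕ) : ℝ) ≤ X - u + 1 := by
      rcases le_total ⌈u⌉₊ (B + 1) with h | h
      · rw [Nat.cast_sub h]
        push_cast
        linarith [Nat.le_ceil u]
      · rw [Nat.sub_eq_zero_of_le h]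
        push_cast
        linarith
    calc _ ≤ ((A + (B + 1 - ⌈u⌉₊ + Z.card) : ℕ) : ℝ) := by exact_mod_cast e1
      _ ≤ _ := by push_cast; linarith
  have hXu : X - u ≤ X * ((1 + 1 / δ) * (2 / T)) := by
    have e1 := rpow_sub_rpow_le (a := (N : ℝ) - R) (b := (N : ℝ) + 1) (s := 1 / c)
      (by positivity) (by linarith) (by linarith) (by linarith [(Nat.cast_nonneg R : (0 : ℝ) ≤ R)])
    rw [← hX, ← hu] at e1
    refine e1.trans ?_
    have e2 : ((N : ℝ) + 1 - (N - R)) / (N + 1) ≤ 2 / T := by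
      rw [div_le_div_iff₀ (by linarith) hT0]
      nlinarith
    have e3 : 0 ≤ ((N : ℝ) + 1 - (N - R)) / (N + 1) :=
      div_nonneg (by linarith [(Nat.cast_nonneg R : (0 : ℝ) ≤ R)]) (by linarith)
    gcongr
  have hlogT : 0 < Real.log T := Real.log_pos hT1
  have hlogR : Real.log T ≤ Real.log (R + 1) := Real.log_le_log hT0 hTR.le
  have hm1 : 16 * ((B : ℝ) - A) / Real.log (R + 1) ^ 2 ≤ X * (16 / Real.log T ^ 2) := by
    calc _ ≤ 16 * X / Real.log T ^ 2 := by
          gcongr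
          linarith [(Nat.cast_nonneg A : (0 : ℝ) ≤ A)]
      _ = _ := by ring
  have hm2 : 32 * S * (R : ℝ) ^ 8 ≤ 384 * (X / T) := by
    calc 32 * S * (R : ℝ) ^ 8 ≤ 32 * S * T ^ 8 := by gcongr
      _ = 384 * (X / T ^ 8) := by rw [hS]; field_simp; norm_num
      _ ≤ 384 * (X / T) := by
        gcongr
        exact hTpow 8 (by norm_num)
  have hm3 : X / Q ≤ X / T := by gcongr
  have hm4 : 1 ≤ X / T := by
    rw [le_div_iff₀ hT0]
    nlinarith
  have hU : (Upsilon c N : ℝ) ≤ A + ((X - u + 1) + Z.card) :=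
    le_trans (by exact_mod_cast hcover) hcard
  -- `388 = 384 + 1 + 1 + 2`: the sieve error, the initial range up to `X / Q`, the rounding in the
  -- end interval, and the `δ`-free part of its length.
  have hfinal : X * ((388 + 2 / δ) / T + 16 / Real.log T ^ 2) =
      388 * (X / T) + X * (1 / δ * (2 / T)) + X * (16 / Real.log T ^ 2) := by
    field_simp
  have hXu' : X * ((1 + 1 / δ) * (2 / T)) = 2 * (X / T) + X * (1 / δ * (2 / T)) := by
    field_simp
  rw [hfinal]
  linarith

/-! ### Choice of parameters and conclusion. -/

lemma log_sq_le_four_mul {x : ℝ} (hx : 1 ≤ x) : Real.log x ^ 2 ≤ 4 * x := by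
  have hx0 : 0 ≤ x := by linarith
  have h1 : Real.log x ≤ 2 * Real.sqrt x := by
    have h := Real.log_le_sub_one_of_pos (Real.sqrt_pos.2 (by linarith : 0 < x))
    rw [Real.log_sqrt hx0] at h
    linarith
  calc Real.log x ^ 2 ≤ (2 * Real.sqrt x) ^ 2 := by
        gcongr
        exact Real.log_nonneg hx
    _ = 4 * x := by rw [mul_pow, Real.sq_sqrt hx0]; norm_num

lemma floor_add_le_and_le_of_le_abs_sub_round {c δ : ℝ} (hc : 0 ≤ c) (h : δ ≤ |c - round c|) :
    (⌊c⌋₊ : ℝ) + δ ≤ c ∧ c ≤ (⌊c⌋₊ : ℝ) + 1 - δ := by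
  rw [abs_sub_round_eq_min] at h
  have h1 := h.trans (min_le_left _ _)
  have h2 := h.trans (min_le_right _ _)
  have h3 : ((⌊c⌋₊ : ℕ) : ℝ) + Int.fract c = c := by
    rw [natCast_floor_eq_intCast_floor hc]
    exact Int.floor_add_fract c
  constructor <;> linarith

/-- `|c - round c|` is the distance `‖c‖` from `c` to the nearest integer. -/
theorem mainTheorem6 (C δ : ℝ) (hC : 0 < C) (hδ : 0 < δ) :
    ∃ K : ℝ, 0 < K ∧
      ∀ (N : ℕ) (c : ℝ), 3 ≤ N → 0 < c → c ≤ C → δ ≤ |c - round c| →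
        (Upsilon c N : ℝ) ≤ K * ((N : ℝ) ^ (1 / c) / Real.log N ^ 2) := by
  -- With `T = N ^ ρ` and `Q = T ^ a`, the choice of `a` makes `Q ^ (1 / 2 ^ s)` at least `T ^ 16`
  -- for all `s ≤ s₀`. The exponent `b` is the power `2 * s₀ + 7` of `Q` plus one to absorb the
  -- constant `K₁`, and `ρ` is set so that `Q ^ b = N ^ (δ / C) ≤ X ^ δ`.
  set s₀ : ℕ := ⌊C⌋₊ with hs₀
  set a : ℕ := 16 * 2 ^ s₀ with ha
  set b : ℕ := 2 * s₀ + 8 with hb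
  have ha16 : 16 ≤ a := by
    rw [ha]; exact Nat.le_mul_of_pos_right 16 (by positivity)
  have ha0 : (16 : ℝ) ≤ a := by exact_mod_cast ha16
  have hb0 : (8 : ℝ) ≤ b := by exact_mod_cast (by omega : 8 ≤ b)
  set ρ : ℝ := δ / (C * (a * b)) with hρ
  have hρ0 : 0 < ρ := by positivity
  set K₁ : ℝ := 4 * (((s₀ : ℝ) + 1) ^ (s₀ + 1) * (1 / δ) ^ (2 * (s₀ + 1))) with hK₁
  have hK₁0 : 0 < K₁ := by positivity
  -- `Q < K₁` forces `log N ≤ L₀`; for these bounded `N` the trivial estimate, with `L₀ ^ 2` in the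
  -- constant, is enough.
  set L₀ : ℝ := Real.log K₁ / (ρ * a) with hL₀
  refine ⟨2 ^ (1 / δ) * (L₀ ^ 2 + (4 * (388 + 2 / δ) + 16) / ρ ^ 2), by positivity,
    fun N c hN hc hcC hcδ => ?_⟩
  obtain ⟨h1, h2⟩ := floor_add_le_and_le_of_le_abs_sub_round hc.le hcδ
  set s : ℕ := ⌊c⌋₊ with hs
  have hs0 : (0 : ℝ) ≤ s := Nat.cast_nonneg s
  have hδ1 : δ ≤ 1 := by linarith
  have hδc : δ ≤ c := by linarith
  have hδC : δ ≤ C := hδc.trans hcC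
  have hss₀ : s ≤ s₀ := Nat.floor_le_floor hcC
  have hN3 : (3 : ℝ) ≤ N := by exact_mod_cast hN
  have hN0 : (0 : ℝ) < N := by linarith
  have hlogN : 0 < Real.log N := Real.log_pos (by linarith)
  set X : ℝ := ((N : ℝ) + 1) ^ (1 / c) with hX
  have hXN : X ≤ 2 ^ (1 / δ) * (N : ℝ) ^ (1 / c) := by
    calc X ≤ (2 * (N : ℝ)) ^ (1 / c) :=
          Real.rpow_le_rpow (by linarith) (by linarith) (by positivity)
      _ = 2 ^ (1 / c) * (N : ℝ) ^ (1 / c) := Real.mul_rpow (by norm_num) hN0.le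
      _ ≤ _ := by
        gcongr
        norm_num
  have hconv : ∀ k : ℝ, k ≤ L₀ ^ 2 + (4 * (388 + 2 / δ) + 16) / ρ ^ 2 → 0 ≤ k →
      (Upsilon c N : ℝ) ≤ X * (k / Real.log N ^ 2) →
      (Upsilon c N : ℝ) ≤ 2 ^ (1 / δ) * (L₀ ^ 2 + (4 * (388 + 2 / δ) + 16) / ρ ^ 2) *
        ((N : ℝ) ^ (1 / c) / Real.log N ^ 2) := by
    intro k hk hk0 h
    refine h.trans ?_
    calc X * (k / Real.log N ^ 2) ≤ (2 ^ (1 / δ) * (N : ℝ) ^ (1 / c)) *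
          ((L₀ ^ 2 + (4 * (388 + 2 / δ) + 16) / ρ ^ 2) / Real.log N ^ 2) := by gcongr
      _ = _ := by ring
  set T : ℝ := (N : ℝ) ^ ρ with hT
  have hT1 : 1 < T := Real.one_lt_rpow (by linarith) hρ0
  have hlogT : Real.log T = ρ * Real.log N := Real.log_rpow hN0 ρ
  set Q : ℝ := T ^ a with hQ
  have hlogQ : Real.log Q = a * (ρ * Real.log N) := by rw [hQ, Real.log_pow, hlogT]
  have hQ0 : 0 < Q := by positivity
  have hQ1 : 1 ≤ Q := one_le_pow₀ hT1.le
  rcases lt_or_ge Q K₁ with hsmall | hlarge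
  · refine hconv (L₀ ^ 2) (by have : 0 ≤ (4 * (388 + 2 / δ) + 16) / ρ ^ 2 := by positivity
                              linarith) (sq_nonneg _) ?_
    have h3 : Real.log N ≤ L₀ := by
      have := Real.log_le_log hQ0 hsmall.le
      rw [hL₀, le_div_iff₀ (by positivity)]
      linarith
    have h4 : 1 ≤ L₀ ^ 2 / Real.log N ^ 2 := by
      rw [one_le_div (by positivity)]
      gcongr
    exact (Upsilon_le_rpow hc N).trans (le_mul_of_one_le_right (by positivity) h4)
  · have hS1 : (1 : ℝ) ≤ ((s₀ : ℝ) + 1) ^ (s₀ + 1) :=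
      one_le_pow₀ (by linarith [(Nat.cast_nonneg s₀ : (0 : ℝ) ≤ s₀)])
    have hδinv : 1 ≤ 1 / δ := by rw [le_div_iff₀ hδ]; linarith
    have hA1 : (1 : ℝ) ≤ (1 / δ) ^ (2 * (s₀ + 1)) := one_le_pow₀ hδinv
    have hQ2 : 2 ≤ Q := by
      refine le_trans ?_ hlarge
      have := one_le_mul_of_one_le_of_one_le hS1 hA1
      linarith
    have hTN : T ^ 2 ≤ N := by
      have hρ2 : ρ * 2 ≤ 1 := by
        rw [hρ, div_mul_eq_mul_div, div_le_one (by positivity)]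
        have : (2 : ℝ) ≤ a * b := by nlinarith
        gcongr
      calc T ^ 2 = (N : ℝ) ^ (ρ * 2) := by
            rw [hT, ← Real.rpow_natCast, ← Real.rpow_mul hN0.le]; norm_num
        _ ≤ (N : ℝ) ^ (1 : ℝ) := Real.rpow_le_rpow_of_exponent_le (by linarith) hρ2
        _ = N := Real.rpow_one _
    have hTQs : T ^ 16 ≤ Q ^ ((1 / 2 : ℝ) ^ s) := by
      calc T ^ 16 = Q ^ ((1 / 2 : ℝ) ^ s₀) := by
            rw [hQ, ← Real.rpow_natCast T a, ← Real.rpow_mul (by linarith), ha,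
              ← Real.rpow_natCast T 16]
            congr 1
            push_cast
            rw [mul_assoc, ← mul_pow]
            norm_num
        _ ≤ Q ^ ((1 / 2 : ℝ) ^ s) := by
            refine Real.rpow_le_rpow_of_exponent_le hQ1 ?_
            exact pow_le_pow_of_le_one (by norm_num) (by norm_num) hss₀
    have hbig : 4 * (Q ^ (2 * s + 7) * ((s : ℝ) + 1) ^ (s + 1) * (1 / δ) ^ (2 * (s + 1))) ≤
        X ^ δ := by
      have e1 : ((s : ℝ) + 1) ^ (s + 1) ≤ ((s₀ : ℝ) + 1) ^ (s₀ + 1) := by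
        have : (s : ℝ) ≤ s₀ := by exact_mod_cast hss₀
        calc ((s : ℝ) + 1) ^ (s + 1) ≤ ((s₀ : ℝ) + 1) ^ (s + 1) := by gcongr
          _ ≤ _ := pow_le_pow_right₀ (by linarith) (by omega)
      calc _ ≤ 4 * (Q ^ (2 * s₀ + 7) * ((s₀ : ℝ) + 1) ^ (s₀ + 1) *
            (1 / δ) ^ (2 * (s₀ + 1))) := by gcongr
        _ = Q ^ (2 * s₀ + 7) * K₁ := by rw [hK₁]; ring
        _ ≤ Q ^ (2 * s₀ + 7) * Q := by gcongr
        _ = (N : ℝ) ^ (δ / C) := by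
          rw [← pow_succ, hQ, ← pow_mul, hT, ← Real.rpow_natCast, ← Real.rpow_mul hN0.le]
          congr 1
          have : ((a * (2 * s₀ + 7 + 1) : ℕ) : ℝ) = a * b := by rw [hb]; push_cast; ring
          rw [this, hρ]
          field_simp
        _ ≤ (N : ℝ) ^ (1 / c * δ) := by
          refine Real.rpow_le_rpow_of_exponent_le (by linarith) ?_
          rw [one_div_mul_eq_div]
          gcongr
        _ ≤ ((N : ℝ) + 1) ^ (1 / c * δ) :=
          Real.rpow_le_rpow hN0.le (by linarith) (by positivity)
        _ = X ^ δ := by rw [hX, Real.rpow_mul (by linarith)]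
    have hmain := Upsilon_le_of_large hδ hδ1 h1 h2 hX hT1 hTN
      (pow_le_pow_right₀ hT1.le ha16) hQ2 hTQs hbig
    refine hconv ((4 * (388 + 2 / δ) + 16) / ρ ^ 2) (by linarith [sq_nonneg L₀]) (by positivity)
      (hmain.trans ?_)
    have hX0 : 0 < X := by positivity
    have hlT0 : 0 < Real.log T := Real.log_pos hT1
    -- The power-saving terms are weakened to the size of the main term; `log T = ρ * log N` then
    -- puts `ρ ^ 2` in the constant.
    have e2 : 1 / T ≤ 4 / Real.log T ^ 2 := by
      rw [div_le_div_iff₀ (by linarith) (by positivity)]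
      linarith [log_sq_le_four_mul hT1.le]
    calc X * ((388 + 2 / δ) / T + 16 / Real.log T ^ 2) =
          X * ((388 + 2 / δ) * (1 / T) + 16 / Real.log T ^ 2) := by ring
      _ ≤ X * ((388 + 2 / δ) * (4 / Real.log T ^ 2) + 16 / Real.log T ^ 2) := by gcongr
      _ = X * ((4 * (388 + 2 / δ) + 16) / ρ ^ 2 / Real.log N ^ 2) := by
          rw [hlogT]; field_simp
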